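/- An instance $I$ of \textsc{MEFE-Matching} consists of a set $X$ of $n$ courses, a set $T$ of $m$ teaching assistants (TAs), utilities $v_x\colon T\to\mathbb{Z}_{\ge 0}$ and positive integer capacities $c_x$ for the courses $x\in X$, utilities $u_t\colon X\to\mathbb{Z}_{\ge 0}$ and grades $g_t\colon X\to\mathbb{Q}_{\ge 0}$ for the TAs $t\in T$, and a threshold $k\in\mathbb{Q}_{\ge 0}$, where $v_x(t)=0$ if and only if $u_t(x)=0$. Put $u_t(\emptyset)=0$. A matching $\mu\colon T\to X\cup\{\emptyset\}$ is \emph{MEFE} (merit-based envy-free egalitarian) if (i) $|\mu^{-1}(x)|=c_x$ for every $x\in X$, and no TA $t$ is assigned to a course $x$ with $u_t(x)=0$; (ii) $\frac{1}{c_x}\sum_{t\in\mu^{-1}(x)}v_x(t)\ge k$ for every $x\in X$; (iii) there are no TAs $t,t'$ with $\mu(t')\in X$, $g_t(\mu(t'))\ge g_{t'}(\mu(t'))$ and $u_t(\mu(t'))>u_t(\mu(t))$. The problem \textsc{MEFE-Matching} is to find an MEFE matching of a given instance, or to report that none exists. \textbf{Theorem.} Let $C$ and $R$ be constants. Restricted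 to the instances in which - every course has capacity at most $C$, - every course $x$ has at most $R$ distinct positive valuations, i.e. $v_x$ takes at most $R$ distinct positive values, - for every course $x$, no two TAs have the same grade in $x$, and - for every TA $t$, the values $u_t(x)$ of the courses $x$ with $u_t(x)>0$ are pairwise distinct, \textsc{MEFE-Matching} is fixed-parameter tractable with respect to the number $n$ of courses: there are an algorithm, a computable function $f$ and a constant $d$ such that the algorithm solves every such instance $I$ in time at most $f(n)\cdot|I|^{d}$, where $|I|$ is the binary encoding length of $I$. -/

import Mathlib

/-! ### Random access machines

Deterministic random access machines with the uniform cost measure and the usual restricted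
arithmetic (addition, subtraction cut off at `0`, halving rounded down; no multiplication), so that
uniform-cost time is polynomially related to Turing machine time. Programs are written with
structured control flow. A program is a finite piece of syntax and names its registers and memory
banks by literals, so it uses only finitely many of them. -/

namespace RAM

/-- Contents of the machine: registers `reg r`, and cells `mem b i` (cell `i` of memory bank `b`),
each holding a natural number. -/
structure State where
  reg : ℕ → ℕ
  mem : ℕ → ℕ → ℕ

/-- Elementary instructions. The first argument of all but `store` is the target register. -/
inductive Instr where
  /-- `reg r := k` for a literal `k` -/
  | const (r k : ℕ)
  /-- `reg r := reg a + reg b` -/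
  | add (r a b : ℕ)
  /-- `reg r := max (reg a - reg b) 0` -/
  | sub (r a b : ℕ)
  /-- `reg r := ⌊reg a / 2⌋` -/
  | half (r a : ℕ)
  /-- indirect read: `reg r := mem b (reg i)` -/
  | load (r b i : ℕ)
  /-- indirect write: `mem b (reg i) := reg r` -/
  | store (b i r : ℕ)

/-- Effect of an elementary instruction. -/
def Instr.apply : Instr → State → State
  | const r k, s => { s with reg := Function.update s.reg r k }
  | add r a b, s => { s with reg := Function.update s.reg r (s.reg a + s.reg b) }
  | sub r a b, s => { s with reg := Function.update s.reg r (s.reg a - s.reg b) }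
  | half r a, s => { s with reg := Function.update s.reg r (s.reg a / 2) }
  | load r b i, s => { s with reg := Function.update s.reg r (s.mem b (s.reg i)) }
  | store b i r, s =>
      { s with mem := Function.update s.mem b (Function.update (s.mem b) (s.reg i) (s.reg r)) }

/-- Programs. -/
inductive Program where
  | instr (i : Instr)
  | seq (p q : Program)
  /-- if `reg r = 0` then `p` else `q` -/
  | ifZero (r : ℕ) (p q : Program)
  /-- while `reg r ≠ 0` do `p` -/
  | loop (r : ℕ) (p : Program)

/-- `Exec p s s' t`: started in `s`, the program `p` halts in `s'` after exactly `t` steps. Every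
elementary instruction and every test of a register costs one step. -/
inductive Exec : Program → State → State → ℕ → Prop
  | instr (i : Instr) (s : State) : Exec (.instr i) s (i.apply s) 1
  | seq {p q : Program} {s s₁ s₂ : State} {t₁ t₂ : ℕ} :
      Exec p s s₁ t₁ → Exec q s₁ s₂ t₂ → Exec (.seq p q) s s₂ (t₁ + t₂)
  | ifZero_zero {r : ℕ} {p q : Program} {s s' : State} {t : ℕ} :
      s.reg r = 0 → Exec p s s' t → Exec (.ifZero r p q) s s' (t + 1)
  | ifZero_ne {r : ℕ} {p q : Program} {s s' : State} {t : ℕ} :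
      s.reg r ≠ 0 → Exec q s s' t → Exec (.ifZero r p q) s s' (t + 1)
  | loop_done {r : ℕ} {p : Program} {s : State} :
      s.reg r = 0 → Exec (.loop r p) s s 1
  | loop_step {r : ℕ} {p : Program} {s s₁ s₂ : State} {t₁ t₂ : ℕ} :
      s.reg r ≠ 0 → Exec p s s₁ t₁ → Exec (.loop r p) s₁ s₂ t₂ →
        Exec (.loop r p) s s₂ (t₁ + t₂ + 1)

/-- The machine is deterministic: the final state and the number of steps are unique. -/
theorem Exec.unique {p : Program} {s s₁ s₂ : State} {t₁ t₂ : ℕ}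
    (h₁ : Exec p s s₁ t₁) (h₂ : Exec p s s₂ t₂) : s₁ = s₂ ∧ t₁ = t₂ := by
  induction h₁ generalizing s₂ t₂ with
  | instr => cases h₂; exact ⟨rfl, rfl⟩
  | seq _ _ ih ih' =>
    cases h₂ with
    | seq k k' =>
      obtain ⟨rfl, rfl⟩ := ih k
      obtain ⟨rfl, rfl⟩ := ih' k'
      exact ⟨rfl, rfl⟩
  | ifZero_zero h _ ih =>
    cases h₂ with
    | ifZero_zero _ k => obtain ⟨rfl, rfl⟩ := ih k; exact ⟨rfl, rfl⟩
    | ifZero_ne h' _ => exact absurd h h'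
  | ifZero_ne h _ ih =>
    cases h₂ with
    | ifZero_zero h' _ => exact absurd h' h
    | ifZero_ne _ k => obtain ⟨rfl, rfl⟩ := ih k; exact ⟨rfl, rfl⟩
  | loop_done h =>
    cases h₂ with
    | loop_done => exact ⟨rfl, rfl⟩
    | loop_step h' _ _ => exact absurd h h'
  | loop_step h _ _ ih ih' =>
    cases h₂ with
    | loop_done h' => exact absurd h' h
    | loop_step _ k k' =>
      obtain ⟨rfl, rfl⟩ := ih k
      obtain ⟨rfl, rfl⟩ := ih' k'
      exact ⟨rfl, rfl⟩

/-- Initial state: the input numbers stand in the first cells of bank `0`, everything else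
is `0`. -/
def init (w : List ℕ) : State where
  reg := fun _ => 0
  mem := fun b i => if b = 0 then w.getD i 0 else 0

/-- The output is read from bank `1`. -/
def State.output (s : State) : ℕ → ℕ := s.mem 1

/-- Size of an input: the total binary length of its numbers, plus one for each number as a
separator. -/
def inputSize (w : List ℕ) : ℕ := (w.map fun a => Nat.size a + 1).sum

/-- Fixed-parameter tractability with parameter `κ` of a problem over the instances `I` with
`Legal I`: some machine halts on every such instance after at most `f (κ I) * |I| ^ d` steps, with
`f` computable and `d` constant, and its output is a correct answer for `I`. -/
def SolvableInFPT {α : Type} (Legal : α → Prop) (encode : α → List ℕ) (κ : α → ℕ)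
    (Correct : α → (ℕ → ℕ) → Prop) : Prop :=
  ∃ (p : Program) (f : ℕ → ℕ) (d : ℕ), Computable f ∧
    ∀ I : α, Legal I → ∃ (s : State) (t : ℕ),
      Exec p (init (encode I)) s t ∧
      t ≤ f (κ I) * inputSize (encode I) ^ d ∧
      Correct I s.output

end RAM

/-! ### Merit-based envy-free egalitarian matchings -/

namespace MEFE

/-- An instance with `n` courses and `m` TAs. -/
structure Instance where
  /-- number of courses -/
  n : ℕ
  /-- number of TAs -/
  m : ℕ
  /-- `v x t`: utility of course `x` for TA `t` -/
  v : Fin n → Fin m → ℕ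
  /-- `u t x`: utility of TA `t` for course `x` -/
  u : Fin m → Fin n → ℕ
  /-- `g t x`: grade of TA `t` in course `x` -/
  g : Fin m → Fin n → ℚ≥0
  /-- `c x`: capacity of course `x` -/
  c : Fin n → ℕ
  /-- threshold for the average utility of each course -/
  k : ℚ≥0
  /-- capacities are positive -/
  c_pos : ∀ x, 0 < c x
  /-- a course gives value `0` to a TA exactly when the TA gives value `0` to the course -/
  v_eq_zero_iff : ∀ x t, v x t = 0 ↔ u t x = 0

namespace Instance

variable (I : Instance)

/-- A matching assigns to each TA a course, or no course (`none`). -/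
abbrev Matching : Type := Fin I.m → Option (Fin I.n)

/-- The TAs assigned to the course `x`. -/
def assigned (μ : I.Matching) (x : Fin I.n) : Finset (Fin I.m) :=
  Finset.univ.filter fun t => μ t = some x

/-- Utility of TA `t` for an outcome; being unassigned has utility `0`. -/
def utility (t : Fin I.m) : Option (Fin I.n) → ℕ
  | none => 0
  | some x => I.u t x

/-- Every course gets exactly as many TAs as its capacity, and no TA is assigned to a course
it values `0`. -/
def Feasible (μ : I.Matching) : Prop :=
  (∀ x, (I.assigned μ x).card = I.c x) ∧ ∀ t x, μ t = some x → I.u t x ≠ 0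

/-- Average utility of course `x` for the TAs assigned to it. -/
def avgUtil (μ : I.Matching) (x : Fin I.n) : ℚ≥0 :=
  (∑ t ∈ I.assigned μ x, (I.v x t : ℚ≥0)) / (I.c x : ℚ≥0)

/-- `t` envies `t'` on merit basis: `t'` is assigned to a course `x` in which the grade of `t` is at
least that of `t'` and which `t` values more than its own outcome. -/
def Envies (μ : I.Matching) (t t' : Fin I.m) : Prop :=
  ∃ x, μ t' = some x ∧ I.g t' x ≤ I.g t x ∧ I.utility t (μ t) < I.utility t (μ t')

/-- Merit-based envy-free egalitarian matchings. -/
def IsMEFE (μ : I.Matching) : Prop :=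
  I.Feasible μ ∧ (∀ x, I.k ≤ I.avgUtil μ x) ∧ ∀ t t', ¬ I.Envies μ t t'

/-- The distinct positive values that the course `x` gives to TAs. -/
def positiveValues (x : Fin I.n) : Finset ℕ :=
  (Finset.univ.image (I.v x)).filter fun q => 0 < q

/-- In each course, no two TAs have the same grade. -/
def DistinctGrades : Prop := ∀ x t t', I.g t x = I.g t' x → t = t'

/-- Each TA gives distinct values to the courses it values positively. -/
def DistinctTAValues : Prop := ∀ t x y, 0 < I.u t x → I.u t x = I.u t y → x = y

/-- The instance as a list of natural numbers: `n`, `m`, the threshold, the capacities, then the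
`n × m` tables of `v`, `u` and of the numerators and denominators of `g`, each listed course by
course (position `x * m + t` holds the entry of course `x` and TA `t`). -/
def encode : List ℕ :=
  [I.n, I.m, I.k.num, I.k.den] ++ List.ofFn I.c
    ++ List.ofFn (fun p : Fin (I.n * I.m) => I.v p.divNat p.modNat)
    ++ List.ofFn (fun p : Fin (I.n * I.m) => I.u p.modNat p.divNat)
    ++ List.ofFn (fun p : Fin (I.n * I.m) => (I.g p.modNat p.divNat).num)
    ++ List.ofFn (fun p : Fin (I.n * I.m) => (I.g p.modNat p.divNat).den)

/-- Outcomes as numbers: `0` for unassigned, `x + 1` for the course with index `x`. -/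
def outcomeCode : Option (Fin I.n) → ℕ
  | none => 0
  | some x => x.val + 1

/-- `out` is a correct answer: either `1` followed by an MEFE matching, listed TA by TA, or `0`
and there is no MEFE matching. -/
def CorrectAnswer (out : ℕ → ℕ) : Prop :=
  (out 0 = 1 ∧ ∃ μ : I.Matching, I.IsMEFE μ ∧ ∀ t : Fin I.m, out (t.val + 1) = I.outcomeCode (μ t)) ∨
  (out 0 = 0 ∧ ¬ ∃ μ : I.Matching, I.IsMEFE μ)

end Instance

/-- The restricted instances: every course has capacity at most `C` and at most `R` distinct positive
valuations, grades are distinct within each course, and each TA has distinct valuations for the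
courses it values positively. -/
def Restricted (C R : ℕ) (I : Instance) : Prop :=
  (∀ x, I.c x ≤ C) ∧ (∀ x, (I.positiveValues x).card ≤ R) ∧ I.DistinctGrades ∧ I.DistinctTAValues

end MEFE

/-! Order the TAs of each course `x` by grade; since grades are distinct, a TA is determined by its
rank. An MEFE matching fills the seats of `x`, seat `i` receiving the `i`-th best TA assigned to
`x`. There are at most `C * n` seats, and a course has at most `R` positive values, so a table of `R
* (C * n)` bits records which value each seat receives. The algorithm tries all `2 ^ (R * (C * n))`
tables, which is the only part that is not polynomial.

For a fixed table `W`, the seats make offers as in deferred acceptance. Every seat has a pointer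
into the ranking of its course, starting at rank `0`. The pointer advances while its current offer
is `Bad`: the TA is not acceptable, has a value that `W` does not allow for this seat, has already
been passed or reached by an earlier seat of the same course, or has been passed or reached by a
seat of a course it prefers. If `W` describes an MEFE matching `μ`, no pointer overtakes the seating
of `μ` (`IsSeating.rank_lt_of_bad`): a TA sitting in its `μ`-seat with a better course at or past it
would envy someone in `μ` (`IsSeating.not_blocking`). The sum of the pointers is therefore bounded,
and the process stops after polynomially many rounds (`isFinal_rounds`).

When no offer is bad, the offers form an MEFE matching (`IsFinal.isMEFE`). No TA holds two offers,
because it strictly prefers one of the courses. Each seat gives the same value as in `μ`, so the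
averages agree. Assigned TAs feel no envy by the definition of `Bad`. An unassigned TA with envy
would be assigned in `μ`, as is every TA that holds an offer; but both matchings assign exactly as
many TAs as there are seats.

Wrong tables do no harm, since every candidate is checked before it is accepted. To obtain an actual
machine, the algorithm is written with bounded sums and loops, compiled with a proven time bound
(`Cmd.runs_compile`), and its cost is bounded by a polynomial in the loop bounds
(`Cmd.exists_cost_le`). -/

namespace RAM

/-! ### Expressions with bounded sums, and their compilation -/

/-- `iterN f k a = f (k-1) (… (f 1 (f 0 a)))`. -/
def iterN {α : Type*} (f : ℕ → α → α) : ℕ → α → α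
  | 0, a => a
  | k + 1, a => f k (iterN f k a)

theorem iterN_rel {α β : Type*} {f : ℕ → α → α} {g : ℕ → β → β} {P : α → β → Prop} {a : α} {b : β}
    (k : ℕ) (h : ∀ i < k, ∀ a b, P a b → P (f i a) (g i b)) (h0 : P a b) :
    P (iterN f k a) (iterN g k b) := by
  induction k with
  | zero => exact h0
  | succ k ih => exact h k (by omega) _ _ (ih fun i hi => h i (by omega))

theorem iterN_inv {α : Type*} {f : ℕ → α → α} {P : ℕ → α → Prop} {a : α} (k : ℕ)
    (h : ∀ i < k, ∀ a, P i a → P (i + 1) (f i a)) (h0 : P 0 a) : P k (iterN f k a) := by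
  induction k with
  | zero => exact h0
  | succ k ih => exact h k (by omega) _ (ih fun i hi => h i (by omega))

/-- Assignment to a register. -/
def State.setReg (s : State) (r k : ℕ) : State := { s with reg := Function.update s.reg r k }

/-- Assignment to a memory cell. -/
def State.setMem (s : State) (b i k : ℕ) : State :=
  { s with mem := Function.update s.mem b (Function.update (s.mem b) i k) }

@[simp] theorem State.setReg_mem (s : State) (r k : ℕ) : (s.setReg r k).mem = s.mem := rfl

@[simp] theorem State.setReg_reg (s : State) (r k q : ℕ) :
    (s.setReg r k).reg q = if q = r then k else s.reg q := by
  simp [setReg, Function.update_apply]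

@[simp] theorem State.setMem_reg (s : State) (b i k : ℕ) : (s.setMem b i k).reg = s.reg := rfl

theorem State.setMem_mem (s : State) (b i k b' : ℕ) :
    (s.setMem b i k).mem b' = if b' = b then Function.update (s.mem b) i k else s.mem b' := by
  simp only [setMem, Function.update_apply]

/-- Arithmetic expressions over variables and memory cells, with bounded sums. -/
inductive Expr where
  | const (k : ℕ)
  | var (v : ℕ)
  | load (b : ℕ) (i : Expr)
  | add (a b : Expr)
  | sub (a b : Expr)
  | half (a : Expr)
  | mul (a b : Expr)
  /-- if `c` is nonzero then `a` else `b` -/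
  | ite (c a b : Expr)
  /-- the sum of `body` over all `v < bound` -/
  | sum (v : ℕ) (bound body : Expr)

namespace Expr

/-- The value of an expression. -/
def eval : Expr → State → ℕ
  | const k, _ => k
  | var v, s => s.reg v
  | load b i, s => s.mem b (i.eval s)
  | add a b, s => a.eval s + b.eval s
  | sub a b, s => a.eval s - b.eval s
  | half a, s => a.eval s / 2
  | mul a b, s => a.eval s * b.eval s
  | ite c a b, s => if c.eval s = 0 then b.eval s else a.eval s
  | sum v L e, s => ∑ i ∈ Finset.range (L.eval s), e.eval (s.setReg v i)

/-- A bound for the time needed to evaluate an expression. -/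
def cost : Expr → State → ℕ
  | const _, _ => 1
  | var _, _ => 2
  | load _ i, s => i.cost s + 1
  | add a b, s => a.cost s + b.cost s + 1
  | sub a b, s => a.cost s + b.cost s + 1
  | half a, s => a.cost s + 1
  | mul a b, s => a.cost s + b.cost s + (9 * Nat.size (a.eval s) + 6)
  | ite c a b, s => c.cost s + a.cost s + b.cost s + 1
  | sum v L e, s =>
      L.cost s + ∑ i ∈ Finset.range (L.eval s), (e.cost (s.setReg v i) + 5) + 9

end Expr

/-- The register that holds a variable. -/
def vreg (v : ℕ) : ℕ := 2 * v

/-- The scratch registers. -/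
def treg (d : ℕ) : ℕ := 2 * d + 1

@[simp] theorem vreg_inj {v w : ℕ} : vreg v = vreg w ↔ v = w := by simp [vreg]
@[simp] theorem treg_inj {v w : ℕ} : treg v = treg w ↔ v = w := by simp [treg]
@[simp] theorem vreg_ne_treg (v d : ℕ) : vreg v ≠ treg d := by simp only [vreg, treg]; omega
@[simp] theorem treg_ne_vreg (v d : ℕ) : treg d ≠ vreg v := (vreg_ne_treg v d).symm

/-- The machine state `s` represents `σ`. -/
structure Sim (σ s : State) : Prop where
  reg : ∀ v, s.reg (vreg v) = σ.reg v
  mem : s.mem = σ.mem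

/-- `s'` agrees with `s` on the scratch registers below `d`. -/
def Keeps (d : ℕ) (s s' : State) : Prop := ∀ j < d, s'.reg (treg j) = s.reg (treg j)

/-- Within time `T` the program `p` started in `s` halts in a state with `Q`. -/
def Runs (p : Program) (s : State) (T : ℕ) (Q : State → Prop) : Prop :=
  ∃ s' t, Exec p s s' t ∧ t ≤ T ∧ Q s'

theorem Runs.instr {i : Instr} {s : State} {Q : State → Prop} (h : Q (i.apply s)) :
    Runs (.instr i) s 1 Q := ⟨_, _, .instr i s, le_rfl, h⟩

theorem Runs.seq {p q : Program} {s : State} {T₁ T₂ : ℕ} {Q : State → Prop}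
    (h : Runs p s T₁ fun s₁ => Runs q s₁ T₂ Q) : Runs (.seq p q) s (T₁ + T₂) Q := by
  obtain ⟨s₁, t₁, e₁, h₁, s₂, t₂, e₂, h₂, hQ⟩ := h
  exact ⟨s₂, _, .seq e₁ e₂, by omega, hQ⟩

theorem Runs.mono {p : Program} {s : State} {T T' : ℕ} {Q Q' : State → Prop}
    (h : Runs p s T Q) (hT : T ≤ T') (hQ : ∀ s, Q s → Q' s) : Runs p s T' Q' := by
  obtain ⟨s', t, e, ht, hs⟩ := h
  exact ⟨s', t, e, ht.trans hT, hQ _ hs⟩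

theorem Runs.ifZero {r : ℕ} {p q : Program} {s : State} {T₁ T₂ : ℕ} {Q : State → Prop}
    (h₁ : s.reg r = 0 → Runs p s T₁ Q) (h₂ : s.reg r ≠ 0 → Runs q s T₂ Q) :
    Runs (.ifZero r p q) s ((if s.reg r = 0 then T₁ else T₂) + 1) Q := by
  by_cases h : s.reg r = 0
  · obtain ⟨s', t, e, ht, hs⟩ := h₁ h
    exact ⟨s', _, .ifZero_zero h e, by simp [h, ht], hs⟩
  · obtain ⟨s', t, e, ht, hs⟩ := h₂ h
    exact ⟨s', _, .ifZero_ne h e, by simp [h, ht], hs⟩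

theorem Runs.loop_done {r : ℕ} {p : Program} {s : State} {Q : State → Prop}
    (h : s.reg r = 0) (hQ : Q s) : Runs (.loop r p) s 1 Q := ⟨_, _, .loop_done h, le_rfl, hQ⟩

theorem Runs.loop_step {r : ℕ} {p : Program} {s : State} {T₁ T₂ : ℕ} {Q : State → Prop}
    (h : s.reg r ≠ 0) (hp : Runs p s T₁ fun s₁ => Runs (.loop r p) s₁ T₂ Q) :
    Runs (.loop r p) s (T₁ + T₂ + 1) Q := by
  obtain ⟨s₁, t₁, e₁, h₁, s₂, t₂, e₂, h₂, hQ⟩ := hp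
  exact ⟨s₂, _, .loop_step h e₁ e₂, by omega, hQ⟩

/-- The program that runs a list of instructions and then `p`. -/
def block : List Instr → Program → Program
  | [], p => p
  | i :: l, p => .seq (.instr i) (block l p)

theorem Runs.block {p : Program} {T : ℕ} {Q : State → Prop} (l : List Instr) {s : State}
    (h : Runs p (l.foldl (fun s i => i.apply s) s) T Q) : Runs (block l p) s (l.length + T) Q := by
  induction l generalizing s with
  | nil => simpa [RAM.block] using h
  | cons i l ih =>
    exact (Runs.seq (Runs.instr (ih h))).mono (by simp; omega) fun _ h => h

@[simp] theorem Instr.apply_const (r k : ℕ) (s : State) :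
    (Instr.const r k).apply s = s.setReg r k := rfl
@[simp] theorem Instr.apply_add (r a b : ℕ) (s : State) :
    (Instr.add r a b).apply s = s.setReg r (s.reg a + s.reg b) := rfl
@[simp] theorem Instr.apply_sub (r a b : ℕ) (s : State) :
    (Instr.sub r a b).apply s = s.setReg r (s.reg a - s.reg b) := rfl
@[simp] theorem Instr.apply_half (r a : ℕ) (s : State) :
    (Instr.half r a).apply s = s.setReg r (s.reg a / 2) := rfl
@[simp] theorem Instr.apply_load (r b i : ℕ) (s : State) :
    (Instr.load r b i).apply s = s.setReg r (s.mem b (s.reg i)) := rfl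
@[simp] theorem Instr.apply_store (b i r : ℕ) (s : State) :
    (Instr.store b i r).apply s = s.setMem b (s.reg i) (s.reg r) := rfl

/-- The multiplication loop: adds `treg d * treg (d+1)` to `treg (d+2)`. -/
def mulLoop (d : ℕ) : Program :=
  .loop (treg d) (block
    [.half (treg (d + 3)) (treg d), .add (treg (d + 4)) (treg (d + 3)) (treg (d + 3)),
      .sub (treg (d + 4)) (treg d) (treg (d + 4))]
    (.seq (.ifZero (treg (d + 4)) (.instr (.const (treg (d + 4)) 0))
        (.instr (.add (treg (d + 2)) (treg (d + 2)) (treg (d + 1)))))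
      (block [.add (treg (d + 1)) (treg (d + 1)) (treg (d + 1)), .const (treg d) 0]
        (.instr (.add (treg d) (treg d) (treg (d + 3)))))))

/-- Multiplication by repeated doubling: each pass strips the lowest bit of `a`, doubles `b`, and
adds `b` to the accumulator if the bit was `1`, so `c + a * b` is invariant. A pass takes at most
nine steps including the test, and there are `Nat.size a` passes. -/
theorem runs_mulLoop (d : ℕ) (σ s₀ : State) (a b c : ℕ) (s : State) (hs : Sim σ s)
    (hk : Keeps d s₀ s) (ha : s.reg (treg d) = a) (hb : s.reg (treg (d + 1)) = b)
    (hc : s.reg (treg (d + 2)) = c) :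
    Runs (mulLoop d) s (9 * Nat.size a + 1) fun s' =>
      Sim σ s' ∧ Keeps d s₀ s' ∧ s'.reg (treg (d + 2)) = c + a * b := by
  induction a using Nat.strong_induction_on generalizing b c s with
  | _ a ih =>
    by_cases h0 : a = 0
    · subst h0
      exact (Runs.loop_done ha ⟨hs, hk, by simp [hc]⟩).mono (by omega) fun _ h => h
    · have hsz : Nat.size a = Nat.size (a / 2) + 1 := by
        rcases Nat.even_or_odd' a with ⟨e, rfl | rfl⟩
        · have := Nat.size_bit (b := false) (n := e) (by simpa [Nat.bit] using h0)
          simpa [Nat.bit] using this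
        · have := Nat.size_bit (b := true) (n := e) (by simp [Nat.bit])
          rw [show (2 * e + 1) / 2 = e by omega]
          simpa [Nat.bit] using this
      refine (Runs.loop_step (T₁ := 8) (T₂ := 9 * Nat.size (a / 2) + 1) (by omega) ?_).mono
        (by omega) fun _ h => h
      refine (Runs.block (T := 5) _ (Runs.seq (T₁ := 2) (T₂ := 3) ?_)).mono (by simp) fun _ h => h
      refine (Runs.ifZero (T₁ := 1) (T₂ := 1) (fun h => Runs.instr ?_)
        (fun h => Runs.instr ?_)).mono (by simp) fun _ h => h
      all_goals
        refine (Runs.block (T := 1) _ (Runs.instr ?_)).mono (by simp) fun _ h => h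
        simp [ha] at h
        refine (ih (a / 2) (by omega) (b + b) _ _ ⟨?_, ?_⟩ ?_ (by simp [ha]) (by simp [hb])
          rfl).mono le_rfl ?_
        · intro v; simp [hs.reg]
        · simp [hs.mem]
        · intro j hj
          have := hk j hj
          simp [this, show j ≠ d by omega, show j ≠ d + 1 by omega, show j ≠ d + 2 by omega,
            show j ≠ d + 3 by omega, show j ≠ d + 4 by omega]
        · rintro s' ⟨h₁, h₂, h₃⟩
          refine ⟨h₁, h₂, h₃.trans ?_⟩
          simp [hc, hb]
          obtain ⟨e, he⟩ : ∃ e, a / 2 = e := ⟨_, rfl⟩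
          rw [he]
          first
          | rw [show a = 2 * e by omega]; ring
          | rw [show a = 2 * e + 1 by omega]; ring

/-- Compilation of expressions; the value is left in scratch register `d`. -/
def Expr.compile : Expr → ℕ → Program
  | const k, d => .instr (.const (treg d) k)
  | var v, d => block [.const (treg d) 0] (.instr (.add (treg d) (treg d) (vreg v)))
  | load b i, d => .seq (i.compile d) (.instr (.load (treg d) b (treg d)))
  | add a b, d => .seq (a.compile d)
      (.seq (b.compile (d + 1)) (.instr (.add (treg d) (treg d) (treg (d + 1)))))
  | sub a b, d => .seq (a.compile d)
      (.seq (b.compile (d + 1)) (.instr (.sub (treg d) (treg d) (treg (d + 1)))))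
  | half a, d => .seq (a.compile d) (.instr (.half (treg d) (treg d)))
  | mul a b, d => .seq (a.compile d) (.seq (b.compile (d + 1))
      (block [.const (treg (d + 2)) 0] (.seq (mulLoop d) (block [.const (treg d) 0]
        (.instr (.add (treg d) (treg d) (treg (d + 2))))))))
  | ite c a b, d => .seq (c.compile d) (.ifZero (treg d) (b.compile d) (a.compile d))
  | sum v L e, d => .seq (L.compile d)
      (block [.const (treg (d + 1)) 0, .const (treg (d + 2)) 0,
          .add (treg (d + 2)) (treg (d + 2)) (vreg v), .const (vreg v) 0]
        (.seq
          (.loop (treg d) (.seq (e.compile (d + 3))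
            (block [.add (treg (d + 1)) (treg (d + 1)) (treg (d + 3)), .const (treg (d + 3)) 1,
                .add (vreg v) (vreg v) (treg (d + 3))]
              (.instr (.sub (treg d) (treg d) (treg (d + 3)))))))
          (block [.const (vreg v) 0, .add (vreg v) (vreg v) (treg (d + 2)), .const (treg d) 0]
            (.instr (.add (treg d) (treg d) (treg (d + 1)))))))

/-- The scratch registers act as a stack: code compiled at level `d` leaves everything below `d`
alone, so a left operand held in `treg d` survives the evaluation of the right operand at level `d +
1`. This is why `Keeps` is part of the conclusion. -/
theorem Expr.runs_compile (e : Expr) (d : ℕ) (σ s : State) (hs : Sim σ s) :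
    Runs (e.compile d) s (e.cost σ) fun s' =>
      Sim σ s' ∧ Keeps d s s' ∧ s'.reg (treg d) = e.eval σ := by
  induction e generalizing d σ s with
  | const k =>
    refine Runs.instr ⟨⟨fun v => ?_, hs.mem⟩, fun j hj => ?_, ?_⟩
    · simp [hs.reg]
    · simp [show j ≠ d by omega]
    · simp [eval]
  | var w =>
    refine Runs.block (T := 1) _ (Runs.instr ⟨⟨fun v => ?_, hs.mem⟩, fun j hj => ?_, ?_⟩)
    · simp [hs.reg]
    · simp [show j ≠ d by omega]
    · simp [eval, hs.reg]
  | load b i ih =>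
    refine Runs.seq ((ih d σ s hs).mono le_rfl ?_)
    rintro s₁ ⟨h₁, k₁, e₁⟩
    refine Runs.instr ⟨⟨fun v => ?_, by exact h₁.mem⟩, fun j hj => ?_, ?_⟩
    · simp [h₁.reg]
    · simp [show j ≠ d by omega, k₁ j hj]
    · simp [eval, e₁, h₁.mem]
  | add a b iha ihb =>
    refine (Runs.seq (T₂ := b.cost σ + 1) ((iha d σ s hs).mono le_rfl ?_)).mono
      (by simp only [cost, ← add_assoc, le_refl]) fun _ h => h
    rintro s₁ ⟨h₁, k₁, e₁⟩
    refine Runs.seq ((ihb (d + 1) σ s₁ h₁).mono le_rfl ?_)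
    rintro s₂ ⟨h₂, k₂, e₂⟩
    refine Runs.instr ⟨⟨fun v => ?_, by exact h₂.mem⟩, fun j hj => ?_, ?_⟩
    · simp [h₂.reg]
    · simp [show j ≠ d by omega, k₁ j hj, k₂ j (by omega)]
    · simp [eval, e₂, k₂ d (by omega), e₁]
  | sub a b iha ihb =>
    refine (Runs.seq (T₂ := b.cost σ + 1) ((iha d σ s hs).mono le_rfl ?_)).mono
      (by simp only [cost, ← add_assoc, le_refl]) fun _ h => h
    rintro s₁ ⟨h₁, k₁, e₁⟩
    refine Runs.seq ((ihb (d + 1) σ s₁ h₁).mono le_rfl ?_)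
    rintro s₂ ⟨h₂, k₂, e₂⟩
    refine Runs.instr ⟨⟨fun v => ?_, by exact h₂.mem⟩, fun j hj => ?_, ?_⟩
    · simp [h₂.reg]
    · simp [show j ≠ d by omega, k₁ j hj, k₂ j (by omega)]
    · simp [eval, e₂, k₂ d (by omega), e₁]
  | half a ih =>
    refine Runs.seq ((ih d σ s hs).mono le_rfl ?_)
    rintro s₁ ⟨h₁, k₁, e₁⟩
    refine Runs.instr ⟨⟨fun v => ?_, by exact h₁.mem⟩, fun j hj => ?_, ?_⟩
    · simp [h₁.reg]
    · simp [show j ≠ d by omega, k₁ j hj]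
    · simp [eval, e₁]
  | mul a b iha ihb =>
    refine (Runs.seq (T₂ := b.cost σ + (9 * Nat.size (a.eval σ) + 6)) ((iha d σ s hs).mono le_rfl ?_)).mono
      (by simp only [cost, ← add_assoc, le_refl]) fun _ h => h
    rintro s₁ ⟨h₁, k₁, e₁⟩
    refine (Runs.seq (T₂ := 9 * Nat.size (a.eval σ) + 6) ((ihb (d + 1) σ s₁ h₁).mono le_rfl ?_)).mono
      (by simp only [← add_assoc, le_refl]) fun _ h => h
    rintro s₂ ⟨h₂, k₂, e₂⟩
    refine (Runs.block (T := 9 * Nat.size (a.eval σ) + 3) _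
      (Runs.seq (T₂ := 2) ((runs_mulLoop d σ s (a.eval σ) (b.eval σ) 0 _ ⟨fun v => ?_, by exact h₂.mem⟩
      (fun j hj => ?_) ?_ ?_ ?_).mono le_rfl ?_))).mono (by simp; omega) fun _ h => h
    · simp [h₂.reg]
    · simp [show j ≠ d + 2 by omega, k₁ j hj, k₂ j (by omega)]
    · simp [k₂ d (by omega), e₁]
    · simp [e₂]
    · simp
    rintro s₃ ⟨h₃, k₃, e₃⟩
    refine Runs.block (T := 1) _ (Runs.instr ⟨⟨fun v => ?_, by exact h₃.mem⟩, fun j hj => ?_, ?_⟩)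
    · simp [h₃.reg]
    · simp [show j ≠ d by omega, k₃ j hj]
    · simp [eval, e₃]
  | ite c a b ihc iha ihb =>
    refine (Runs.seq (T₂ := a.cost σ + b.cost σ + 1) ((ihc d σ s hs).mono le_rfl ?_)).mono
      (by simp only [cost, ← add_assoc, le_refl]) fun _ h => h
    rintro s₁ ⟨h₁, k₁, e₁⟩
    refine (Runs.ifZero (T₁ := b.cost σ) (T₂ := a.cost σ)
      (fun h => (ihb d σ s₁ h₁).mono le_rfl ?_)
      (fun h => (iha d σ s₁ h₁).mono le_rfl ?_)).mono (by split_ifs <;> omega) fun _ h => h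
    all_goals
      rintro s₂ ⟨h₂, k₂, e₂⟩
      exact ⟨h₂, fun j hj => (k₂ j hj).trans (k₁ j hj), by simp [e₂, eval, ← e₁, h]⟩
  | sum w L e ihL ihe =>
    refine (Runs.seq (T₂ := ∑ i ∈ Finset.range (L.eval σ), (e.cost (σ.setReg w i) + 5) + 9)
      ((ihL d σ s hs).mono le_rfl ?_)).mono
      (by simp only [cost, ← add_assoc, le_refl]) fun _ h => h
    rintro s₁ ⟨h₁, k₁, e₁⟩
    refine (Runs.block (T := ∑ i ∈ Finset.range (L.eval σ), (e.cost (σ.setReg w i) + 5) + 5) _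
      (Runs.seq (T₁ := ∑ i ∈ Finset.range (L.eval σ), (e.cost (σ.setReg w i) + 5) + 1) (T₂ := 4)
        (Runs.mono (Q := fun s' => ∃ k, Sim (σ.setReg w k) s' ∧ Keeps d s s' ∧
          s'.reg (treg (d + 2)) = σ.reg w ∧
          s'.reg (treg (d + 1)) = ∑ i ∈ Finset.range (L.eval σ), e.eval (σ.setReg w i))
          ?_ le_rfl ?_))).mono (by simp; omega) fun _ h => h
    -- Generalised to `l` remaining passes from index `k` on with partial sum `c`, so that induction
    -- on `l` applies. The old value of the summation variable waits in `treg (d + 2)` and is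
    -- restored after the loop.
    · have key : ∀ (l k c : ℕ) (s' : State), Sim (σ.setReg w k) s' → Keeps d s s' →
          s'.reg (treg (d + 2)) = σ.reg w → s'.reg (treg d) = l → s'.reg (treg (d + 1)) = c →
          Runs (.loop (treg d) (.seq (e.compile (d + 3))
            (block [.add (treg (d + 1)) (treg (d + 1)) (treg (d + 3)), .const (treg (d + 3)) 1,
                .add (vreg w) (vreg w) (treg (d + 3))]
              (.instr (.sub (treg d) (treg d) (treg (d + 3))))))) s'
            (∑ i ∈ Finset.range l, (e.cost (σ.setReg w (k + i)) + 5) + 1) fun s' =>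
            ∃ k', Sim (σ.setReg w k') s' ∧ Keeps d s s' ∧
          s'.reg (treg (d + 2)) = σ.reg w ∧
          s'.reg (treg (d + 1)) = c + ∑ i ∈ Finset.range l, e.eval (σ.setReg w (k + i)) := by
        intro l
        induction l with
        | zero =>
          intro k c s' h hk hw hl hc
          exact (Runs.loop_done hl ⟨k, h, hk, hw, by simp [hc]⟩).mono (by simp) fun _ h => h
        | succ l ih =>
          intro k c s' h hk hw hl hc
          refine (Runs.loop_step (T₁ := e.cost (σ.setReg w k) + 4)
            (T₂ := ∑ i ∈ Finset.range l, (e.cost (σ.setReg w (k + 1 + i)) + 5) + 1) (by omega)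
            (Runs.seq ((ihe (d + 3) _ _ h).mono le_rfl ?_))).mono ?_ fun _ h => h
          · rintro s₂ ⟨h₂, k₂, e₂⟩
            refine Runs.block (T := 1) _ (Runs.instr ?_)
            refine (ih (k + 1) (c + e.eval (σ.setReg w k)) _ ⟨fun v => ?_, by exact h₂.mem⟩
              (fun j hj => ?_) ?_ ?_ ?_).mono le_rfl ?_
            · by_cases hv : v = w <;> simp [h₂.reg, hv]
            · simp [show j ≠ d by omega, show j ≠ d + 1 by omega, show j ≠ d + 3 by omega,
                k₂ j (by omega), hk j hj]
            · simp [k₂ (d + 2) (by omega), hw]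
            · simp [k₂ d (by omega), hl]
            · simp [k₂ (d + 1) (by omega), e₂, hc]
            · rintro s₃ ⟨k', h₃, k₃, w₃, c₃⟩
              refine ⟨k', h₃, k₃, w₃, c₃.trans ?_⟩
              rw [Finset.sum_range_succ' _ l]
              simp only [add_zero, add_assoc, add_comm 1]
              omega
          · rw [Finset.sum_range_succ' _ l]
            simp only [add_zero, add_assoc, add_comm 1]
            omega
      have := key (L.eval σ) 0 0
      simp only [zero_add] at this
      refine this _ ⟨fun v => ?_, by exact h₁.mem⟩ (fun j hj => ?_) ?_ ?_ ?_
      · by_cases hv : v = w <;> simp [h₁.reg, hv]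
      · simp [show j ≠ d + 1 by omega, show j ≠ d + 2 by omega, k₁ j hj]
      · simp [h₁.reg]
      · simp [e₁]
      · simp
    · rintro s₂ ⟨k, h₂, k₂, w₂, c₂⟩
      refine Runs.block (T := 1) _ (Runs.instr ⟨⟨fun v => ?_, by exact h₂.mem⟩, fun j hj => ?_, ?_⟩)
      · by_cases hv : v = w <;> simp [h₂.reg, hv, w₂]
      · simp [show j ≠ d by omega, k₂ j hj]
      · simp [eval, c₂]

end RAM

/-! ### Commands with bounded loops, and their compilation -/

namespace RAM

/-- Commands over variables and memory cells, with bounded loops only. -/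
inductive Cmd where
  | skip
  | assign (v : ℕ) (e : Expr)
  /-- `mem b i := e` -/
  | store (b : ℕ) (i e : Expr)
  | seq (c₁ c₂ : Cmd)
  /-- if `e` is nonzero then `c₁` else `c₂` -/
  | ite (e : Expr) (c₁ c₂ : Cmd)
  /-- run `c` for all values of `v` below the bound, in increasing order -/
  | forLt (v : ℕ) (bound : Expr) (c : Cmd)

namespace Cmd

/-- The effect of a command. -/
def sem : Cmd → State → State
  | skip, s => s
  | assign v e, s => s.setReg v (e.eval s)
  | store b i e, s => s.setMem b (i.eval s) (e.eval s)
  | seq c₁ c₂, s => c₂.sem (c₁.sem s)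
  | ite e c₁ c₂, s => if e.eval s = 0 then c₂.sem s else c₁.sem s
  | forLt v L c, s => iterN (fun i s => c.sem (s.setReg v i)) (L.eval s) s

/-- A bound for the running time of a command. -/
def cost : Cmd → State → ℕ
  | skip, _ => 1
  | assign _ e, s => e.cost s + 2
  | store _ i e, s => i.cost s + e.cost s + 1
  | seq c₁ c₂, s => c₁.cost s + c₂.cost (c₁.sem s)
  | ite e c₁ c₂, s => e.cost s + (if e.eval s = 0 then c₂.cost s else c₁.cost s) + 1
  | forLt v L c, s => L.cost s + ∑ i ∈ Finset.range (L.eval s),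
      (c.cost ((iterN (fun i s => c.sem (s.setReg v i)) i s).setReg v i) + 6) + 2

/-- Compilation of commands; scratch registers below `d` are left alone. -/
def compile : Cmd → ℕ → Program
  | skip, d => .instr (.const (treg d) 0)
  | assign v e, d => .seq (e.compile d)
      (block [.const (vreg v) 0] (.instr (.add (vreg v) (vreg v) (treg d))))
  | store b i e, d => .seq (i.compile d) (.seq (e.compile (d + 1))
      (.instr (.store b (treg d) (treg (d + 1)))))
  | seq c₁ c₂, d => .seq (c₁.compile d) (c₂.compile d)
  | ite e c₁ c₂, d => .seq (e.compile d) (.ifZero (treg d) (c₂.compile d) (c₁.compile d))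
  | forLt v L c, d => .seq (L.compile d) (block [.const (treg (d + 1)) 0]
      (.loop (treg d) (block [.const (vreg v) 0, .add (vreg v) (vreg v) (treg (d + 1))]
        (.seq (c.compile (d + 2)) (block [.const (treg (d + 2)) 1,
            .add (treg (d + 1)) (treg (d + 1)) (treg (d + 2))]
          (.instr (.sub (treg d) (treg d) (treg (d + 2)))))))))

theorem runs_compile (c : Cmd) (d : ℕ) (σ s : State) (hs : Sim σ s) :
    Runs (c.compile d) s (c.cost σ) fun s' => Sim (c.sem σ) s' ∧ Keeps d s s' := by
  induction c generalizing d σ s with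
  | skip =>
    refine Runs.instr ⟨⟨fun v => ?_, hs.mem⟩, fun j hj => ?_⟩
    · simp [hs.reg, sem]
    · simp [show j ≠ d by omega]
  | assign w e =>
    refine Runs.seq ((e.runs_compile d σ s hs).mono le_rfl ?_)
    rintro s₁ ⟨h₁, k₁, e₁⟩
    refine Runs.block (T := 1) _ (Runs.instr ⟨⟨fun v => ?_, by exact h₁.mem⟩, fun j hj => ?_⟩)
    · by_cases h : v = w <;> simp [h₁.reg, sem, h, e₁]
    · simp [k₁ j hj]
  | store b i e =>
    refine (Runs.seq (T₂ := e.cost σ + 1) ((i.runs_compile d σ s hs).mono le_rfl ?_)).mono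
      (by simp only [cost, ← add_assoc, le_refl]) fun _ h => h
    rintro s₁ ⟨h₁, k₁, e₁⟩
    refine Runs.seq ((e.runs_compile (d + 1) σ s₁ h₁).mono le_rfl ?_)
    rintro s₂ ⟨h₂, k₂, e₂⟩
    refine Runs.instr ⟨⟨fun v => ?_, ?_⟩, fun j hj => ?_⟩
    · simp [h₂.reg, sem]
    · simp [sem, State.setMem, h₂.mem, e₂, k₂ d (by omega), e₁]
    · simp [k₂ j (by omega), k₁ j hj]
  | seq c₁ c₂ ih₁ ih₂ =>
    refine Runs.seq ((ih₁ d σ s hs).mono le_rfl ?_)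
    rintro s₁ ⟨h₁, k₁⟩
    refine (ih₂ d _ s₁ h₁).mono le_rfl ?_
    rintro s₂ ⟨h₂, k₂⟩
    exact ⟨h₂, fun j hj => (k₂ j hj).trans (k₁ j hj)⟩
  | ite e c₁ c₂ ih₁ ih₂ =>
    refine (Runs.seq (T₂ := (if e.eval σ = 0 then c₂.cost σ else c₁.cost σ) + 1)
      ((e.runs_compile d σ s hs).mono le_rfl ?_)).mono
      (by simp only [cost, ← add_assoc, le_refl]) fun _ h => h
    rintro s₁ ⟨h₁, k₁, e₁⟩
    refine (Runs.ifZero (T₁ := c₂.cost σ) (T₂ := c₁.cost σ)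
      (fun h => (ih₂ d σ s₁ h₁).mono le_rfl ?_)
      (fun h => (ih₁ d σ s₁ h₁).mono le_rfl ?_)).mono (by simp [e₁]) fun _ h => h
    all_goals
      rintro s₂ ⟨h₂, k₂⟩
      exact ⟨by simpa [sem, ← e₁, h] using h₂, fun j hj => (k₂ j hj).trans (k₁ j hj)⟩
  | forLt w L c ih =>
    refine (Runs.seq (T₂ := ∑ i ∈ Finset.range (L.eval σ),
      (c.cost ((iterN (fun i s => c.sem (s.setReg w i)) i σ).setReg w i) + 6) + 2)
      ((L.runs_compile d σ s hs).mono le_rfl ?_)).mono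
      (by simp only [cost, ← add_assoc, le_refl]) fun _ h => h
    rintro s₁ ⟨h₁, k₁, e₁⟩
    -- Again `l` passes remain and `k` are done. The true counter lives in scratch registers and is
    -- copied to the loop variable at the start of each pass, so the body may overwrite that
    -- variable.
    have key : ∀ (l k : ℕ) (s' : State),
        Sim (iterN (fun i s => c.sem (s.setReg w i)) k σ) s' → Keeps d s s' →
        s'.reg (treg d) = l → s'.reg (treg (d + 1)) = k →
        Runs (.loop (treg d) (block [.const (vreg w) 0, .add (vreg w) (vreg w) (treg (d + 1))]
          (.seq (c.compile (d + 2)) (block [.const (treg (d + 2)) 1,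
            .add (treg (d + 1)) (treg (d + 1)) (treg (d + 2))]
          (.instr (.sub (treg d) (treg d) (treg (d + 2)))))))) s'
          (∑ i ∈ Finset.range l, (c.cost ((iterN (fun i s => c.sem (s.setReg w i))
            (k + i) σ).setReg w (k + i)) + 6) + 1) fun s' =>
          Sim (iterN (fun i s => c.sem (s.setReg w i)) (k + l) σ) s' ∧ Keeps d s s' := by
      intro l
      induction l with
      | zero =>
        intro k s' h hk hl _
        exact (Runs.loop_done hl ⟨h, hk⟩).mono (by simp) fun _ h => h
      | succ l ihl =>
        intro k s' h hk hl hi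
        refine (Runs.loop_step (T₁ := 2 + (c.cost ((iterN (fun i s => c.sem (s.setReg w i))
            k σ).setReg w k) + 3))
          (T₂ := ∑ i ∈ Finset.range l, (c.cost ((iterN (fun i s => c.sem (s.setReg w i))
            (k + 1 + i) σ).setReg w (k + 1 + i)) + 6) + 1) (by omega)
          (Runs.block _ (Runs.seq ((ih (d + 2) ((iterN (fun i s => c.sem (s.setReg w i))
            k σ).setReg w k) _ ⟨fun v => ?_, by exact h.mem⟩).mono le_rfl ?_)))).mono ?_
            fun _ h => h
        · by_cases hv : v = w <;> simp [h.reg, hv, hi]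
        · rintro s₂ ⟨h₂, k₂⟩
          refine Runs.block (T := 1) _ (Runs.instr ?_)
          refine (ihl (k + 1) _ ⟨fun v => ?_, by exact h₂.mem⟩ (fun j hj => ?_) ?_ ?_).mono
            le_rfl ?_
          · simp [h₂.reg, iterN]
          · have := k₂ j (by omega)
            simp at this
            simp [show j ≠ d by omega, show j ≠ d + 1 by omega, show j ≠ d + 2 by omega,
              this, hk j hj]
          · have := k₂ d (by omega)
            simp at this
            simp [this, hl]
          · have := k₂ (d + 1) (by omega)
            simp at this
            simp [this, hi]
          · rintro s₃ ⟨h₃, k₃⟩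
            rw [show k + 1 + l = k + (l + 1) by omega] at h₃
            exact ⟨h₃, k₃⟩
        · rw [Finset.sum_range_succ' _ l]
          simp only [add_zero, add_assoc, add_comm 1]
          omega
    have := key (L.eval σ) 0
    simp only [zero_add] at this
    refine (Runs.block (T := ∑ i ∈ Finset.range (L.eval σ),
      (c.cost ((iterN (fun i s => c.sem (s.setReg w i)) i σ).setReg w i) + 6) + 1) _
      ((this _ ⟨fun v => ?_, by exact h₁.mem⟩ (fun j hj => ?_) ?_ ?_).mono le_rfl
        fun _ h => h)).mono (by simp; omega) fun _ h => h
    · simp [h₁.reg, iterN]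
    · simp [show j ≠ d + 1 by omega, k₁ j hj]
    · simp [e₁]
    · simp

end Cmd

/-! ### Running time as a polynomial in the loop bounds -/

/-- In states whose memory bank `0` is `M`, all bounds of sums in the expression and all binary
lengths of left factors are at most `B`. -/
def Expr.Safe (M : ℕ → ℕ) (B : ℕ) : Expr → Prop
  | const _ => True
  | var _ => True
  | load _ i => i.Safe M B
  | add a b => a.Safe M B ∧ b.Safe M B
  | sub a b => a.Safe M B ∧ b.Safe M B
  | half a => a.Safe M B
  | mul a b => (∀ σ : State, σ.mem 0 = M → Nat.size (a.eval σ) ≤ B) ∧ a.Safe M B ∧ b.Safe M B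
  | ite c a b => c.Safe M B ∧ a.Safe M B ∧ b.Safe M B
  | sum _ L e => (∀ σ : State, σ.mem 0 = M → L.eval σ ≤ B) ∧ L.Safe M B ∧ e.Safe M B

/-- In states whose memory bank `0` is `M`, all bounds of loops and sums in the command and all
binary lengths of left factors are at most `B`, and the command does not write to bank `0`. -/
def Cmd.Safe (M : ℕ → ℕ) (B : ℕ) : Cmd → Prop
  | skip => True
  | assign _ e => e.Safe M B
  | store b i e => b ≠ 0 ∧ i.Safe M B ∧ e.Safe M B
  | seq c₁ c₂ => c₁.Safe M B ∧ c₂.Safe M B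
  | ite e c₁ c₂ => e.Safe M B ∧ c₁.Safe M B ∧ c₂.Safe M B
  | forLt _ L c => (∀ σ : State, σ.mem 0 = M → L.eval σ ≤ B) ∧ L.Safe M B ∧ c.Safe M B

/-- Since the input bank is never overwritten, loop bounds certified for states with bank `0` equal
to `M` remain valid throughout the run. -/
theorem Cmd.Safe.sem_mem_zero {M : ℕ → ℕ} {B : ℕ} {c : Cmd} (h : c.Safe M B) {σ : State}
    (hσ : σ.mem 0 = M) : (c.sem σ).mem 0 = M := by
  induction c generalizing σ with
  | skip => exact hσ
  | assign v e => exact hσ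
  | store b i e => simp [sem, State.setMem_mem, h.1.symm, hσ]
  | seq c₁ c₂ ih₁ ih₂ => exact ih₂ h.2 (ih₁ h.1 hσ)
  | ite e c₁ c₂ ih₁ ih₂ =>
    simp only [sem]
    split_ifs
    · exact ih₂ h.2.2 hσ
    · exact ih₁ h.2.1 hσ
  | forLt v L c ih =>
    exact iterN_inv (P := fun _ (s : State) => s.mem 0 = M) _ (fun i _ s hs => ih h.2.2 (by exact hs)) hσ

-- The polynomial is built from the syntax alone, before `M` and `B` are chosen; hence one
-- polynomial serves all instances. A sum contributes its bound times the cost of its body.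
open Polynomial in
theorem Expr.exists_cost_le (e : Expr) : ∃ F : ℕ[X], ∀ (M : ℕ → ℕ) (B : ℕ), e.Safe M B →
    ∀ σ : State, σ.mem 0 = M → e.cost σ ≤ F.eval B := by
  induction e with
  | const k => exact ⟨1, fun M B _ σ _ => by simp [cost]⟩
  | var v => exact ⟨2, fun M B _ σ _ => by simp [cost]⟩
  | load b i ih =>
    obtain ⟨F, hF⟩ := ih
    refine ⟨F + 1, fun M B h σ hσ => ?_⟩
    have := hF M B h σ hσ
    simp [cost]; omega
  | add a b iha ihb | sub a b iha ihb =>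
    obtain ⟨F, hF⟩ := iha
    obtain ⟨G, hG⟩ := ihb
    refine ⟨F + G + 1, fun M B h σ hσ => ?_⟩
    have := hF M B h.1 σ hσ
    have := hG M B h.2 σ hσ
    simp [cost]; omega
  | half a ih =>
    obtain ⟨F, hF⟩ := ih
    refine ⟨F + 1, fun M B h σ hσ => ?_⟩
    have := hF M B h σ hσ
    simp [cost]; omega
  | mul a b iha ihb =>
    obtain ⟨F, hF⟩ := iha
    obtain ⟨G, hG⟩ := ihb
    refine ⟨F + G + (9 * X + 6), fun M B h σ hσ => ?_⟩
    have := hF M B h.2.1 σ hσ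
    have := hG M B h.2.2 σ hσ
    have := h.1 σ hσ
    simp [cost]; omega
  | ite c a b ihc iha ihb =>
    obtain ⟨F, hF⟩ := iha
    obtain ⟨G, hG⟩ := ihb
    obtain ⟨H, hH⟩ := ihc
    refine ⟨F + G + H + 1, fun M B h σ hσ => ?_⟩
    have := hF M B h.2.1 σ hσ
    have := hG M B h.2.2 σ hσ
    have := hH M B h.1 σ hσ
    simp [cost]; omega
  | sum v L e ihL ihe =>
    obtain ⟨F, hF⟩ := ihL
    obtain ⟨G, hG⟩ := ihe
    refine ⟨F + X * (G + 5) + 9, fun M B h σ hσ => ?_⟩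
    have h₁ := hF M B h.2.1 σ hσ
    have h₂ : ∑ i ∈ Finset.range (L.eval σ), (e.cost (σ.setReg v i) + 5) ≤
        B * (G.eval B + 5) := by
      refine (Finset.sum_le_card_nsmul _ _ (G.eval B + 5) fun i _ => ?_).trans ?_
      · have := hG M B h.2.2 (σ.setReg v i) hσ
        omega
      · simpa using h.1 σ hσ
    simp [cost]; omega

open Polynomial in
theorem Cmd.exists_cost_le (c : Cmd) : ∃ F : ℕ[X], ∀ (M : ℕ → ℕ) (B : ℕ), c.Safe M B →
    ∀ σ : State, σ.mem 0 = M → c.cost σ ≤ F.eval B := by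
  induction c with
  | skip => exact ⟨1, fun M B _ σ _ => by simp [cost]⟩
  | assign v e =>
    obtain ⟨F, hF⟩ := e.exists_cost_le
    refine ⟨F + 2, fun M B h σ hσ => ?_⟩
    have := hF M B h σ hσ
    simp [cost]; omega
  | store b i e =>
    obtain ⟨F, hF⟩ := e.exists_cost_le
    obtain ⟨G, hG⟩ := i.exists_cost_le
    refine ⟨F + G + 1, fun M B h σ hσ => ?_⟩
    have := hF M B h.2.2 σ hσ
    have := hG M B h.2.1 σ hσ
    simp [cost]; omega
  | seq c₁ c₂ ih₁ ih₂ =>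
    obtain ⟨F, hF⟩ := ih₁
    obtain ⟨G, hG⟩ := ih₂
    refine ⟨F + G, fun M B h σ hσ => ?_⟩
    have := hF M B h.1 σ hσ
    have := hG M B h.2 _ (h.1.sem_mem_zero hσ)
    simp [cost]; omega
  | ite e c₁ c₂ ih₁ ih₂ =>
    obtain ⟨F, hF⟩ := ih₁
    obtain ⟨G, hG⟩ := ih₂
    obtain ⟨H, hH⟩ := e.exists_cost_le
    refine ⟨F + G + H + 1, fun M B h σ hσ => ?_⟩
    have := hF M B h.2.1 σ hσ
    have := hG M B h.2.2 σ hσ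
    have := hH M B h.1 σ hσ
    simp only [cost, eval_add, eval_one]
    split_ifs <;> omega
  | forLt v L c ih =>
    obtain ⟨F, hF⟩ := L.exists_cost_le
    obtain ⟨G, hG⟩ := ih
    refine ⟨F + X * (G + 6) + 2, fun M B h σ hσ => ?_⟩
    have h₁ := hF M B h.2.1 σ hσ
    have h₂ : ∑ i ∈ Finset.range (L.eval σ),
        (c.cost ((iterN (fun i s => c.sem (s.setReg v i)) i σ).setReg v i) + 6) ≤
        B * (G.eval B + 6) := by
      refine (Finset.sum_le_card_nsmul _ _ (G.eval B + 6) fun i _ => ?_).trans ?_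
      · have := hG M B h.2.2 ((iterN (fun i s => c.sem (s.setReg v i)) i σ).setReg v i)
          (iterN_inv (P := fun _ (s : State) => s.mem 0 = M) _
            (fun i _ s hs => h.2.2.sem_mem_zero (by exact hs)) hσ)
        omega
      · simpa using h.1 σ hσ
    simp [cost]; omega

-- Brings a polynomial into the form required of an FPT bound, where factors depending on `C` and
-- `R` can be pulled out of the power.
open Polynomial in
theorem exists_eval_le_mul_pow (F : ℕ[X]) : ∃ K d : ℕ, ∀ a, F.eval a ≤ K * (a + 1) ^ d := by
  induction F using Polynomial.induction_on' with
  | add p q hp hq =>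
    obtain ⟨K₁, d₁, h₁⟩ := hp
    obtain ⟨K₂, d₂, h₂⟩ := hq
    refine ⟨K₁ + K₂, max d₁ d₂, fun a => ?_⟩
    rw [eval_add, add_mul]
    gcongr
    · exact (h₁ a).trans (by gcongr <;> simp)
    · exact (h₂ a).trans (by gcongr <;> simp)
  | monomial n k =>
    refine ⟨k, n, fun a => ?_⟩
    rw [eval_monomial]
    gcongr
    omega

end RAM

/-! ### Ranks, value indices and seatings -/

namespace MEFE.Instance

variable (I : Instance)

/-- The number of TAs with a better grade in the course `x` than `t`. -/
def rank (x : Fin I.n) (t : Fin I.m) : ℕ := (Finset.univ.filter fun t' => I.g t x < I.g t' x).card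

/-- The index of the value `v x t` among the positive values of the course `x`. -/
def valueIndex (x : Fin I.n) (t : Fin I.m) : ℕ :=
  ((I.positiveValues x).filter fun q => q < I.v x t).card

variable {I}

theorem rank_le_rank_iff {x : Fin I.n} {t t' : Fin I.m} :
    I.rank x t ≤ I.rank x t' ↔ I.g t' x ≤ I.g t x := by
  constructor
  · intro h
    by_contra! hlt
    refine absurd h (not_le.mpr (Finset.card_lt_card ?_))
    refine Finset.ssubset_iff_subset_ne.mpr ⟨fun a ha => ?_, fun he => ?_⟩
    · simp only [Finset.mem_filter, Finset.mem_univ, true_and] at ha ⊢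
      exact hlt.trans ha
    · have : t' ∈ Finset.univ.filter fun a => I.g t x < I.g a x := by simpa using hlt
      rw [← he] at this
      simp at this
  · intro h
    refine Finset.card_le_card fun a ha => ?_
    simp only [Finset.mem_filter, Finset.mem_univ, true_and] at ha ⊢
    exact h.trans_lt ha

theorem rank_lt (x : Fin I.n) (t : Fin I.m) : I.rank x t < I.m := by
  have : (Finset.univ.filter fun t' => I.g t x < I.g t' x).card < (Finset.univ : Finset (Fin I.m)).card :=
    Finset.card_lt_card (Finset.ssubset_iff_subset_ne.mpr ⟨Finset.subset_univ _, fun he => by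
      have := Finset.mem_univ t
      rw [← he] at this
      simp at this⟩)
  simpa [rank] using this

theorem DistinctGrades.rank_injective (h : I.DistinctGrades) (x : Fin I.n) :
    Function.Injective (I.rank x) := fun t t' e =>
  h x t t' (le_antisymm (rank_le_rank_iff.mp e.ge) (rank_le_rank_iff.mp e.le))

/-- Ranks embed the TAs into `Fin I.m`, and an injective map of a finite set to itself is
surjective. -/
theorem DistinctGrades.exists_rank_eq (h : I.DistinctGrades) (x : Fin I.n) {r : ℕ} (hr : r < I.m) :
    ∃ t, I.rank x t = r := by
  have hinj : Function.Injective fun t => (⟨I.rank x t, rank_lt x t⟩ : Fin I.m) := fun t t' e =>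
    h.rank_injective x (by simpa using e)
  obtain ⟨t, ht⟩ := (Finite.injective_iff_surjective.mp hinj) ⟨r, hr⟩
  exact ⟨t, by simpa using ht⟩

theorem v_mem_positiveValues {x : Fin I.n} {t : Fin I.m} (h : I.v x t ≠ 0) :
    I.v x t ∈ I.positiveValues x := by
  simp [positiveValues, Nat.pos_of_ne_zero h]

theorem valueIndex_lt {x : Fin I.n} {t : Fin I.m} (h : I.v x t ≠ 0) :
    I.valueIndex x t < (I.positiveValues x).card :=
  Finset.card_lt_card (Finset.filter_ssubset.mpr ⟨_, v_mem_positiveValues h, lt_irrefl _⟩)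

theorem valueIndex_lt_valueIndex {x : Fin I.n} {t t' : Fin I.m} (h : I.v x t ≠ 0)
    (hlt : I.v x t < I.v x t') : I.valueIndex x t < I.valueIndex x t' := by
  refine Finset.card_lt_card (Finset.ssubset_iff_subset_ne.mpr ⟨fun a ha => ?_, fun he => ?_⟩)
  · rw [Finset.mem_filter] at ha ⊢
    exact ⟨ha.1, ha.2.trans hlt⟩
  · have : I.v x t ∈ (I.positiveValues x).filter fun q => q < I.v x t' :=
      Finset.mem_filter.mpr ⟨v_mem_positiveValues h, hlt⟩
    rw [← he] at this
    simp at this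

/-- This allows a guess to name a value by its index below `R` rather than by its unbounded
magnitude. -/
theorem v_eq_of_valueIndex_eq {x : Fin I.n} {t t' : Fin I.m} (h : I.v x t ≠ 0) (h' : I.v x t' ≠ 0)
    (e : I.valueIndex x t = I.valueIndex x t') : I.v x t = I.v x t' := by
  rcases lt_trichotomy (I.v x t) (I.v x t') with hlt | he | hlt
  · exact absurd e (valueIndex_lt_valueIndex h hlt).ne
  · exact he
  · exact absurd e (valueIndex_lt_valueIndex h' hlt).ne'

/-- `r x i` is the rank of the `i`-th best TA assigned to `x` by `μ`. -/
structure IsSeating (μ : I.Matching) (r : Fin I.n → ℕ → ℕ) : Prop where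
  exists_ta : ∀ x, ∀ i < I.c x, ∃ t, μ t = some x ∧ I.rank x t = r x i
  lt : ∀ x i j, i < j → j < I.c x → r x i < r x j
  exists_seat : ∀ t x, μ t = some x → ∃ i < I.c x, I.rank x t = r x i

/-- The seating lists the ranks of the TAs assigned to a course in increasing order; the value `0`
past the capacity is never used. -/
theorem exists_isSeating (hg : I.DistinctGrades) {μ : I.Matching} (hμ : I.Feasible μ) :
    ∃ r, I.IsSeating μ r := by
  have hcard : ∀ x, ((I.assigned μ x).image (I.rank x)).card = I.c x := fun x => by
    rw [Finset.card_image_of_injective _ (hg.rank_injective x), hμ.1 x]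
  have hr : ∀ x i (h : i < I.c x), (if h : i < I.c x then
      ((I.assigned μ x).image (I.rank x)).orderEmbOfFin (hcard x) ⟨i, h⟩ else 0) =
      ((I.assigned μ x).image (I.rank x)).orderEmbOfFin (hcard x) ⟨i, h⟩ := fun x i h => by simp [h]
  refine ⟨fun x i => if h : i < I.c x then
    ((I.assigned μ x).image (I.rank x)).orderEmbOfFin (hcard x) ⟨i, h⟩ else 0,
    fun x i hi => ?_, fun x i j hij hj => ?_, fun t x ht => ?_⟩
  · have := Finset.orderEmbOfFin_mem _ (hcard x) ⟨i, hi⟩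
    rw [Finset.mem_image] at this
    obtain ⟨t, ht, he⟩ := this
    exact ⟨t, by simpa [assigned] using ht, he.trans (hr x i hi).symm⟩
  · rw [hr x i (hij.trans hj), hr x j hj]
    simpa using hij
  · have : I.rank x t ∈ ((I.assigned μ x).image (I.rank x)) :=
      Finset.mem_image_of_mem _ (by simpa [assigned] using ht)
    rw [← Finset.mem_coe, ← Finset.range_orderEmbOfFin _ (hcard x)] at this
    obtain ⟨i, hi⟩ := this
    exact ⟨i, i.2, by rw [hr x i i.2, ← hi]⟩

/-- The table `W` marks, for every seat, exactly the value of the TA on that seat. -/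
def Marks (C R : ℕ) (W : ℕ → ℕ) (μ : I.Matching) (r : Fin I.n → ℕ → ℕ) : Prop :=
  ∀ x, ∀ i < I.c x, ∀ t, μ t = some x → I.rank x t = r x i → ∀ q < R,
    W (R * (C * x + i) + q) ≠ 0 ↔ q = I.valueIndex x t

variable (I) in
/-- The TA with rank `ρ (C * x + i)`, to whom seat `i` of the course `x` makes its current offer,
is not admissible for that seat or also has an offer, or a rejected offer, that it prefers. -/
def Bad (C R : ℕ) (W ρ : ℕ → ℕ) (x : Fin I.n) (i : ℕ) : Prop :=
  i < I.c x ∧ ∃ t, I.rank x t = ρ (C * x + i) ∧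
    (I.u t x = 0 ∨ W (R * (C * x + i) + I.valueIndex x t) = 0 ∨
      (∃ i' < i, I.rank x t ≤ ρ (C * x + i')) ∨
      ∃ x', I.u t x < I.u t x' ∧ ∃ i' < I.c x', I.rank x' t ≤ ρ (C * x' + i'))

/-- The pointers `ρ` are at or before `r` on all seats. -/
def Below (C : ℕ) (ρ : ℕ → ℕ) (r : Fin I.n → ℕ → ℕ) : Prop :=
  ∀ x, ∀ i < I.c x, ρ (C * x + i) ≤ r x i

/-! ### Bad offers and the matching read off from final pointers -/

section Lattice

variable {C R : ℕ} {W ρ : ℕ → ℕ} {μ : I.Matching} {r : Fin I.n → ℕ → ℕ}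

/-- The pointer has not passed the TA `t'` that `μ` puts on this seat, so a TA at or before the
pointer has a grade at least that of `t'`. If it preferred `x` to its outcome in `μ`, it would envy
`t'`. -/
theorem IsSeating.not_blocking (hs : I.IsSeating μ r) (hμ : I.IsMEFE μ) (hρ : I.Below C ρ r)
    {x : Fin I.n} {i : ℕ} (hi : i < I.c x) {t : Fin I.m} (ht : I.rank x t ≤ ρ (C * x + i)) :
    I.u t x ≤ I.utility t (μ t) := by
  obtain ⟨t', h, he⟩ := hs.exists_ta x i hi
  by_contra! hlt
  refine hμ.2.2 t t' ⟨x, h, rank_le_rank_iff.mp ?_, by simpa [h, utility] using hlt⟩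
  exact ht.trans ((hρ x i hi).trans he.ge)

/-- The key invariant: a pointer that has reached its seat in `μ` is never bad, so advancing a bad
pointer does not overtake `μ`. -/
theorem IsSeating.rank_lt_of_bad (hs : I.IsSeating μ r) (hμ : I.IsMEFE μ)
    (hR : ∀ x, (I.positiveValues x).card ≤ R) (hg : I.DistinctGrades)
    (hW : Marks C R W μ r) (hρ : I.Below C ρ r)
    {x : Fin I.n} {i : ℕ} (hb : I.Bad C R W ρ x i) : ρ (C * x + i) < r x i := by
  obtain ⟨hi, t, ht, hb⟩ := hb
  refine lt_of_le_of_ne (hρ x i hi) fun he => ?_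
  obtain ⟨t₀, h₀, h₁⟩ := hs.exists_ta x i hi
  -- With the pointer exactly at `r x i`, the offered TA is the one `μ` seats there. The four
  -- reasons for a bad offer then contradict, in turn, feasibility, the marks, the strict order of
  -- the seats, and `not_blocking`.
  obtain rfl : t = t₀ := hg.rank_injective x (by rw [ht, he, h₁])
  have hu := hμ.1.2 t x h₀
  rcases hb with h | h | ⟨i', hi', h⟩ | ⟨x', hlt, i', hi', h⟩
  · exact hu h
  · refine (hW x i hi t h₀ h₁ _ ((valueIndex_lt fun h => hu ?_).trans_le (hR x))).mpr rfl h
    exact (I.v_eq_zero_iff x t).mp h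
  · have := hρ x i' (hi'.trans hi)
    have := hs.lt x i' i hi' hi
    omega
  · have := hs.not_blocking hμ hρ hi' h
    simp only [h₀, utility] at this
    omega

variable (I) in
/-- Each seat takes the TA to whom it makes its current offer. -/
noncomputable def ofRanks (C : ℕ) (ρ : ℕ → ℕ) : I.Matching := fun t =>
  open Classical in
  if h : ∃ x, ∃ i < I.c x, I.rank x t = ρ (C * x + i) then some h.choose else none

/-- Final pointers: no offer is bad and all pointers are on or before the seating of an MEFE
matching. -/
structure IsFinal (C R : ℕ) (W ρ : ℕ → ℕ) (μ : I.Matching) (r : Fin I.n → ℕ → ℕ) : Prop where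
  restricted : Restricted C R I
  mefe : I.IsMEFE μ
  seating : I.IsSeating μ r
  marks : Marks C R W μ r
  below : I.Below C ρ r
  not_bad : ∀ x i, ¬ I.Bad C R W ρ x i

namespace IsFinal

variable (h : IsFinal C R W ρ μ r)
include h

theorem seat {x : Fin I.n} {i : ℕ} (hi : i < I.c x) {t : Fin I.m}
    (ht : I.rank x t = ρ (C * x + i)) : I.u t x ≠ 0 ∧ W (R * (C * x + i) + I.valueIndex x t) ≠ 0 ∧
      (∀ i' < i, ρ (C * x + i') < ρ (C * x + i)) ∧
      ∀ x', I.u t x < I.u t x' → ∀ i' < I.c x', ρ (C * x' + i') < I.rank x' t := by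
  have := h.not_bad x i
  simp only [Bad, hi, true_and, not_exists, not_and, not_or, not_le] at this
  obtain ⟨h₁, h₂, h₃, h₄⟩ := this t ht
  exact ⟨h₁, h₂, fun i' hi' => ht ▸ h₃ i' hi', h₄⟩

/-- The pointer is at most the rank of an actual TA, so it has not run off the end of the list. -/
theorem exists_ta {x : Fin I.n} {i : ℕ} (hi : i < I.c x) : ∃ t, I.rank x t = ρ (C * x + i) := by
  obtain ⟨t₀, -, h₁⟩ := h.seating.exists_ta x i hi
  exact h.restricted.2.2.1.exists_rank_eq x
    (((h.below x i hi).trans h₁.ge).trans_lt (rank_lt x t₀))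

/-- Of two offers from different courses the TA strictly prefers one, as its positive values are
distinct, and the other offer would be bad. Within one course the pointers strictly increase along
the seats. -/
theorem seat_unique {x x' : Fin I.n} {i i' : ℕ} (hi : i < I.c x) (hi' : i' < I.c x')
    {t : Fin I.m} (ht : I.rank x t = ρ (C * x + i)) (ht' : I.rank x' t = ρ (C * x' + i')) :
    x = x' ∧ i = i' := by
  obtain ⟨h₁, -, h₃, h₄⟩ := h.seat hi ht
  obtain ⟨h₁', -, h₃', h₄'⟩ := h.seat hi' ht'
  have hx : x = x' := by
    by_contra hne
    rcases lt_trichotomy (I.u t x) (I.u t x') with hlt | he | hlt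
    · exact absurd (h₄ x' hlt i' hi') (by omega)
    · exact hne (h.restricted.2.2.2 t x x' (by omega) he)
    · exact absurd (h₄' x hlt i hi) (by omega)
  subst hx
  refine ⟨rfl, ?_⟩
  rcases lt_trichotomy i i' with hlt | he | hlt
  · have := h₃' i hlt; omega
  · exact he
  · have := h₃ i' hlt; omega

theorem ofRanks_eq_some_iff {t : Fin I.m} {x : Fin I.n} :
    I.ofRanks C ρ t = some x ↔ ∃ i < I.c x, I.rank x t = ρ (C * x + i) := by
  unfold ofRanks
  split_ifs with he
  · obtain ⟨i, hi, e⟩ := he.choose_spec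
    refine ⟨fun hx => ?_, fun ⟨i', hi', e'⟩ => ?_⟩
    · rw [Option.some.injEq] at hx
      exact hx ▸ ⟨i, hi, e⟩
    · rw [(h.seat_unique hi hi' e e').1]
  · simp only [false_iff]
    exact fun hx => he ⟨x, hx⟩

/-- The seats of a course in bijection with the TAs assigned to it. -/
theorem sum_assigned (x : Fin I.n) (ta : ℕ → Fin I.m)
    (hta : ∀ i < I.c x, I.rank x (ta i) = ρ (C * x + i)) (f : Fin I.m → ℕ) :
    ∑ t ∈ I.assigned (I.ofRanks C ρ) x, f t = ∑ i ∈ Finset.range (I.c x), f (ta i) := by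
  symm
  refine Finset.sum_bij (fun i _ => ta i) (fun i hi => ?_) (fun i hi j hj e => ?_)
    (fun t ht => ?_) fun _ _ => rfl
  · rw [Finset.mem_range] at hi
    simpa [assigned, h.ofRanks_eq_some_iff] using ⟨i, hi, hta i hi⟩
  · rw [Finset.mem_range] at hi hj
    exact (h.seat_unique hi hj (hta i hi) (e ▸ hta j hj)).2
  · simp only [assigned, Finset.mem_filter, Finset.mem_univ, true_and,
      h.ofRanks_eq_some_iff] at ht
    obtain ⟨i, hi, e⟩ := ht
    exact ⟨i, Finset.mem_range.mpr hi, h.restricted.2.2.1.rank_injective x ((hta i hi).trans e.symm)⟩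

theorem card_assigned (x : Fin I.n) : (I.assigned (I.ofRanks C ρ) x).card = I.c x := by
  have : Nonempty (Fin I.m) := ⟨(h.exists_ta (I.c_pos x)).choose⟩
  choose! ta hta using fun i (hi : i < I.c x) => h.exists_ta hi
  rw [Finset.card_eq_sum_ones, h.sum_assigned x ta hta]
  simp

-- Applied both to `μ` and to the matching of the pointers: full capacities force the two to assign
-- equally many TAs.
omit h in
theorem card_matched {ν : I.Matching} (hν : ∀ x, (I.assigned ν x).card = I.c x) :
    (Finset.univ.filter fun t => ν t ≠ none).card = ∑ x, I.c x := by
  have : (Finset.univ.filter fun t => ν t ≠ none) = Finset.univ.biUnion (I.assigned ν) := by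
    ext t
    simp [assigned, Option.ne_none_iff_exists']
  rw [this, Finset.card_biUnion]
  · exact Finset.sum_congr rfl fun x _ => hν x
  · intro x _ y _ hxy
    refine Finset.disjoint_left.mpr fun t hx hy => hxy ?_
    simp only [assigned, Finset.mem_filter, Finset.mem_univ, true_and] at hx hy
    exact Option.some.inj (hx.symm.trans hy)

/-- Being unassigned has utility `0`, so an unassigned TA of `μ` at or before the pointer of an
acceptable course would contradict `not_blocking`. -/
theorem matched_of_rank_le {x : Fin I.n} {i : ℕ} (hi : i < I.c x) {t : Fin I.m}
    (ht : I.rank x t ≤ ρ (C * x + i)) (hu : 0 < I.u t x) : μ t ≠ none := fun hn => by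
  have := h.seating.not_blocking h.mefe h.below hi ht
  simp only [hn, utility] at this
  omega

theorem isMEFE : I.IsMEFE (I.ofRanks C ρ) := by
  refine ⟨⟨h.card_assigned, fun t x ht => ?_⟩, fun x => ?_, ?_⟩
  · obtain ⟨i, hi, e⟩ := h.ofRanks_eq_some_iff.mp ht
    exact (h.seat hi e).1
  · refine (h.mefe.2.1 x).trans ?_
    unfold avgUtil
    -- The averages are not merely at least those of `μ` but equal: seat by seat, the mark forces
    -- the same value index and hence the same value.
    refine le_of_eq (congrArg (fun q : ℚ≥0 => q / (I.c x : ℚ≥0)) ?_)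
    have : Nonempty (Fin I.m) := ⟨(h.exists_ta (I.c_pos x)).choose⟩
    choose! ta hta using fun i (hi : i < I.c x) => h.exists_ta hi
    choose! tb htb using fun i (hi : i < I.c x) => h.seating.exists_ta x i hi
    norm_cast
    rw [h.sum_assigned x ta hta]
    symm
    refine Finset.sum_bij (fun i _ => tb i) (fun i hi => ?_) (fun i hi j hj e => ?_)
      (fun t ht => ?_) fun i hi => ?_
    · rw [Finset.mem_range] at hi
      simpa [assigned] using (htb i hi).1
    · rw [Finset.mem_range] at hi hj
      have h₁ := (htb i hi).2
      have h₂ := (htb j hj).2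
      rw [e, h₂] at h₁
      rcases lt_trichotomy i j with hlt | he | hlt
      · have := h.seating.lt x i j hlt hj; omega
      · exact he
      · have := h.seating.lt x j i hlt hi; omega
    · simp only [assigned, Finset.mem_filter, Finset.mem_univ, true_and] at ht
      obtain ⟨i, hi, e⟩ := h.seating.exists_seat t x ht
      exact ⟨i, Finset.mem_range.mpr hi,
        h.restricted.2.2.1.rank_injective x ((htb i hi).2.trans e.symm)⟩
    · rw [Finset.mem_range] at hi
      obtain ⟨h₁, h₂, -, -⟩ := h.seat hi (hta i hi)
      have hv : I.v x (ta i) ≠ 0 := fun hv => h₁ ((I.v_eq_zero_iff x _).mp hv)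
      refine v_eq_of_valueIndex_eq hv
        (fun hv => h.mefe.1.2 _ x (htb i hi).1 ((I.v_eq_zero_iff x _).mp hv)) ?_
      exact (h.marks x i hi (tb i) (htb i hi).1 (htb i hi).2 _
        ((valueIndex_lt hv).trans_le (h.restricted.2.1 x))).mp h₂
  · rintro t t' ⟨x', ht', hgr, hlt⟩
    obtain ⟨i', hi', e'⟩ := h.ofRanks_eq_some_iff.mp ht'
    have hle : I.rank x' t ≤ ρ (C * x' + i') := (rank_le_rank_iff.mpr hgr).trans e'.le
    simp only [ht', utility] at hlt
    cases ht : I.ofRanks C ρ t with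
    | some x =>
      obtain ⟨i, hi, e⟩ := h.ofRanks_eq_some_iff.mp ht
      simp only [ht] at hlt
      exact absurd ((h.seat hi e).2.2.2 x' hlt i' hi') (by omega)
    | none =>
      simp only [ht] at hlt
      -- An unassigned envious TA would make the set assigned by `μ` strictly larger than the set
      -- assigned by the pointers, although both have size `∑ x, I.c x`.
      have hsub : insert t (Finset.univ.filter fun t => I.ofRanks C ρ t ≠ none) ⊆
          Finset.univ.filter fun t => μ t ≠ none := by
        intro s hs
        simp only [Finset.mem_insert, Finset.mem_filter, Finset.mem_univ, true_and] at hs ⊢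
        rcases hs with rfl | hs
        · exact h.matched_of_rank_le hi' hle hlt
        · obtain ⟨x, hx⟩ := Option.ne_none_iff_exists'.mp hs
          obtain ⟨i, hi, e⟩ := h.ofRanks_eq_some_iff.mp hx
          exact h.matched_of_rank_le hi e.le (Nat.pos_of_ne_zero (h.seat hi e).1)
      have := Finset.card_le_card hsub
      rw [Finset.card_insert_of_notMem (by simpa using ht), card_matched h.card_assigned,
        card_matched h.mefe.1.1] at this
      omega

/-- By `seat_unique` at most one term is nonzero, so a double sum computes the outcome without a
search. -/
theorem sum_eq_outcomeCode (t : Fin I.m) :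
    (∑ x : Fin I.n, ∑ i ∈ Finset.range C,
      if i < I.c x ∧ I.rank x t = ρ (C * x + i) then x.val + 1 else 0) =
      I.outcomeCode (I.ofRanks C ρ t) := by
  cases ht : I.ofRanks C ρ t with
  | none =>
    refine Finset.sum_eq_zero fun x _ => Finset.sum_eq_zero fun i _ => if_neg fun hx => ?_
    rw [h.ofRanks_eq_some_iff.mpr ⟨i, hx⟩] at ht
    simp at ht
  | some x =>
    obtain ⟨i, hi, e⟩ := h.ofRanks_eq_some_iff.mp ht
    rw [Finset.sum_eq_single x, Finset.sum_eq_single i, if_pos ⟨hi, e⟩]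
    · rfl
    · exact fun j _ hj => if_neg fun hx => hj (h.seat_unique hx.1 hi hx.2 e).2
    · exact fun hn => absurd (Finset.mem_range.mpr (hi.trans_le (h.restricted.1 x))) hn
    · exact fun y _ hy => Finset.sum_eq_zero fun j _ =>
        if_neg fun hx => hy (h.seat_unique hx.1 hi hx.2 e).1
    · simp

end IsFinal

/-! ### Advancing the pointers until none is bad -/

variable (I C R W) in
open Classical in
/-- Advance the pointer of a seat if its current offer is bad. -/
noncomputable def bump (x i : ℕ) (ρ : ℕ → ℕ) : ℕ → ℕ :=
  if ∃ y : Fin I.n, y.val = x ∧ I.Bad C R W ρ y i then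
    Function.update ρ (C * x + i) (ρ (C * x + i) + 1) else ρ

variable (I C R W) in
/-- Advance all seats, one after the other. -/
noncomputable def round (ρ : ℕ → ℕ) : ℕ → ℕ :=
  RAM.iterN (fun x => RAM.iterN (fun i => I.bump C R W x i) C) I.n ρ

variable (I C) in
/-- The total progress of the pointers. -/
def potential (ρ : ℕ → ℕ) : ℕ := ∑ x : Fin I.n, ∑ i ∈ Finset.range (I.c x), ρ (C * x + i)

/-- Uniqueness of quotient and remainder. It separates the cells of different seats, and with `R` in
place of `C` also the bits of different seats. -/
theorem seat_index_inj {x x' i i' : ℕ} (hi : i < C) (hi' : i' < C)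
    (h : C * x + i = C * x' + i') : x = x' ∧ i = i' := by
  have h₁ := congrArg (· / C) h
  have h₂ := congrArg (· % C) h
  simp only [Nat.mul_add_mod, Nat.mod_eq_of_lt hi, Nat.mod_eq_of_lt hi'] at h₂
  simp only [Nat.mul_add_div (by omega : 0 < C), Nat.div_eq_of_lt hi, Nat.div_eq_of_lt hi',
    add_zero] at h₁
  exact ⟨h₁, h₂⟩

theorem potential_lt_bump {x : Fin I.n} {i : ℕ} (hb : I.Bad C R W ρ x i) :
    I.potential C ρ < I.potential C (I.bump C R W x i ρ) := by
  have hle : ρ ≤ I.bump C R W x i ρ := by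
    intro j
    unfold bump
    split_ifs
    · rw [Function.update_apply]
      split_ifs with h <;> simp [h]
    · rfl
  have hx : I.bump C R W x i ρ (C * x + i) = ρ (C * x + i) + 1 := by
    rw [bump, if_pos ⟨x, rfl, hb⟩, Function.update_self]
  refine Finset.sum_lt_sum (fun y _ => Finset.sum_le_sum fun j _ => hle _)
    ⟨x, Finset.mem_univ _, Finset.sum_lt_sum (fun j _ => hle _)
      ⟨i, Finset.mem_range.mpr hb.1, by omega⟩⟩

theorem bump_of_not_bad {x i : ℕ} (h : ∀ y : Fin I.n, y.val = x → ¬ I.Bad C R W ρ y i) :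
    I.bump C R W x i ρ = ρ := if_neg fun ⟨y, hy, hb⟩ => h y hy hb

theorem bump_below (hI : Restricted C R I) (hs : I.IsSeating μ r) (hμ : I.IsMEFE μ)
    (hW : Marks C R W μ r) (hρ : I.Below C ρ r) (x i : ℕ) : I.Below C (I.bump C R W x i ρ) r := by
  by_cases h : ∃ y : Fin I.n, y.val = x ∧ I.Bad C R W ρ y i
  · obtain ⟨y, rfl, hb⟩ := h
    have hlt := hs.rank_lt_of_bad hμ hI.2.1 hI.2.2.1 hW hρ hb
    intro z j hj
    rw [bump, if_pos ⟨y, rfl, hb⟩, Function.update_apply]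
    split_ifs with he
    · obtain ⟨h₁, rfl⟩ := seat_index_inj (hj.trans_le (hI.1 z)) (hb.1.trans_le (hI.1 y)) he
      obtain rfl := Fin.ext h₁
      exact hlt
    · exact hρ z j hj
  · rw [bump, if_neg h]
    exact hρ

theorem round_below (hI : Restricted C R I) (hs : I.IsSeating μ r) (hμ : I.IsMEFE μ)
    (hW : Marks C R W μ r) (hρ : I.Below C ρ r) : I.Below C (I.round C R W ρ) r :=
  RAM.iterN_inv (P := fun _ ρ => I.Below C ρ r) _ (fun x _ _ hx =>
    RAM.iterN_inv (P := fun _ ρ => I.Below C ρ r) _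
      (fun i _ _ h => bump_below hI hs hμ hW h x i) hx) hρ

theorem round_eq_self (h : ∀ x i, ¬ I.Bad C R W ρ x i) : I.round C R W ρ = ρ :=
  RAM.iterN_inv (P := fun _ ρ' => ρ' = ρ) _ (fun x _ _ hx =>
    RAM.iterN_inv (P := fun _ ρ' => ρ' = ρ) _
      (fun _ _ _ he => by subst he; exact bump_of_not_bad fun y _ => h y _) hx) rfl

/-- Seats are treated one after the other, so badness may change during a round. The invariant is
that either nothing has moved and no seat treated so far was bad, or the potential has already
grown; a later bump cannot lower it again. -/
theorem not_bad_or_potential_lt (hC : ∀ x, I.c x ≤ C) :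
    (∀ x i, ¬ I.Bad C R W ρ x i) ∨ I.potential C ρ < I.potential C (I.round C R W ρ) := by
  have step : ∀ (x : Fin I.n) i ρ', I.potential C ρ < I.potential C ρ' →
      I.potential C ρ < I.potential C (I.bump C R W x i ρ') := fun x i ρ' h => by
    by_cases hb : I.Bad C R W ρ' x i
    · exact h.trans (potential_lt_bump hb)
    · rwa [bump_of_not_bad fun y hy => by rwa [Fin.ext hy]]
  have := RAM.iterN_inv (f := fun x => RAM.iterN (fun i => I.bump C R W x i) C) (a := ρ)
    (P := fun k ρ' => ((∀ x : Fin I.n, x.val < k → ∀ i < C, ¬ I.Bad C R W ρ x i) ∧ ρ' = ρ) ∨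
      I.potential C ρ < I.potential C ρ') I.n (fun x hx ρ₁ h₁ => ?_) (by simp)
  · refine this.imp (fun h x i hb => ?_) id
    exact h.1 x x.2 i (hb.1.trans_le (hC x)) hb
  · have := RAM.iterN_inv (f := fun i => I.bump C R W x i) (a := ρ₁)
      (P := fun k ρ' => ((∀ y : Fin I.n, y.val < x → ∀ i < C, ¬ I.Bad C R W ρ y i) ∧
        (∀ i < k, ¬ I.Bad C R W ρ ⟨x, hx⟩ i) ∧ ρ' = ρ) ∨
      I.potential C ρ < I.potential C ρ') C (fun i hi ρ₂ h₂ => ?_) ?_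
    · refine this.imp (fun h => ⟨fun y hy i hi => ?_, h.2.2⟩) id
      rcases Nat.lt_succ_iff_lt_or_eq.mp hy with hlt | he
      · exact h.1 y hlt i hi
      · rw [show y = ⟨x, hx⟩ from Fin.ext he]
        exact h.2.1 i hi
    · rcases h₂ with ⟨h, h', rfl⟩ | h
      · by_cases hb : I.Bad C R W ρ₂ ⟨x, hx⟩ i
        · exact .inr (potential_lt_bump hb)
        · refine .inl ⟨h, fun j hj => ?_, bump_of_not_bad fun y hy => ?_⟩
          · rcases Nat.lt_succ_iff_lt_or_eq.mp hj with hlt | rfl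
            · exact h' j hlt
            · exact hb
          · rwa [show y = ⟨x, hx⟩ from Fin.ext hy]
      · exact .inr (step ⟨x, hx⟩ i ρ₂ h)
    · exact h₁.imp (fun h => ⟨h.1, by simp, h.2⟩) id

/-- Each round that starts with a bad offer raises the potential, while the pointers stay below `μ`,
so the potential is at most `I.n * (C * I.m)`. One more round than this must have reached a state
without bad offers, which later rounds leave fixed. -/
theorem isFinal_rounds (hI : Restricted C R I) (hs : I.IsSeating μ r) (hμ : I.IsMEFE μ)
    (hW : Marks C R W μ r) (hρ : ∀ x : Fin I.n, ∀ i < I.c x, ρ (C * x + i) = 0) :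
    IsFinal C R W (RAM.iterN (fun _ => I.round C R W) (C * (I.n * I.m) + 1) ρ) μ r := by
  have hbelow : ∀ k, I.Below C (RAM.iterN (fun _ => I.round C R W) k ρ) r := fun k =>
    RAM.iterN_inv (P := fun _ ρ => I.Below C ρ r) _ (fun _ _ _ h => round_below hI hs hμ hW h)
      (fun x i hi => by simp [hρ x i hi])
  refine ⟨hI, hμ, hs, hW, hbelow _, ?_⟩
  have := RAM.iterN_inv (f := fun _ => I.round C R W) (a := ρ)
    (P := fun k ρ => (∀ x i, ¬ I.Bad C R W ρ x i) ∨ k ≤ I.potential C ρ) (C * (I.n * I.m) + 1)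
    (fun k _ ρ h => ?_) (by simp)
  · refine this.resolve_right fun h => ?_
    have hle : I.potential C (RAM.iterN (fun _ => I.round C R W) (C * (I.n * I.m) + 1) ρ) ≤
        ∑ _x : Fin I.n, C * I.m := by
      refine Finset.sum_le_sum fun x _ => (Finset.sum_le_card_nsmul _ _ I.m fun i hi => ?_).trans ?_
      · rw [Finset.mem_range] at hi
        obtain ⟨t, -, ht⟩ := hs.exists_ta x i hi
        exact (hbelow _ x i hi).trans (ht ▸ (rank_lt x t).le)
      · simpa using Nat.mul_le_mul_right _ (hI.1 x)
    simp only [Finset.sum_const, Finset.card_univ, Fintype.card_fin, smul_eq_mul] at hle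
    have : I.n * (C * I.m) = C * (I.n * I.m) := by ring
    omega
  · rcases h with h | h
    · exact .inl (by rwa [round_eq_self h])
    · rcases not_bad_or_potential_lt (W := W) (R := R) (ρ := ρ) hI.1 with h' | h'
      · exact .inl (by rwa [round_eq_self h'])
      · exact .inr (by omega)

end Lattice

end MEFE.Instance

/-! ### Conditions as expressions -/

namespace RAM.Expr

/-- Read as a condition, an expression holds if its value is nonzero. -/
def Holds (e : Expr) (s : State) : Prop := e.eval s ≠ 0

/-- The expression `a ≤ b`. -/
def le (a b : Expr) : Expr := sub (const 1) (sub a b)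
/-- The expression `a < b`. -/
def lt (a b : Expr) : Expr := le (add a (const 1)) b
/-- Negation. -/
def not (a : Expr) : Expr := ite a (const 0) (const 1)
/-- Conjunction. -/
def and (a b : Expr) : Expr := ite a b (const 0)
/-- Disjunction. -/
def or (a b : Expr) : Expr := ite a (const 1) b
/-- The expression `a = b`. -/
def eq (a b : Expr) : Expr := and (le a b) (le b a)
/-- The expression `∃ v < L, e`. -/
def ex (v : ℕ) (L e : Expr) : Expr := sum v L e
/-- The expression `∀ v < L, e`. -/
def all (v : ℕ) (L e : Expr) : Expr := not (ex v L (not e))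
/-- The value `1` or `0` of a condition. -/
def ind (e : Expr) : Expr := ite e (const 1) (const 0)

variable {a b c e L i : Expr} {v k : ℕ} {s : State}

@[simp] theorem eval_const : (const k).eval s = k := rfl
@[simp] theorem eval_var : (var v).eval s = s.reg v := rfl
@[simp] theorem eval_load : (load k i).eval s = s.mem k (i.eval s) := rfl
@[simp] theorem eval_add : (add a b).eval s = a.eval s + b.eval s := rfl
@[simp] theorem eval_sub : (sub a b).eval s = a.eval s - b.eval s := rfl
@[simp] theorem eval_half : (half a).eval s = a.eval s / 2 := rfl
@[simp] theorem eval_mul : (mul a b).eval s = a.eval s * b.eval s := rfl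
@[simp] theorem eval_sum :
    (sum v L e).eval s = ∑ i ∈ Finset.range (L.eval s), e.eval (s.setReg v i) := rfl
open Classical in
@[simp] theorem eval_ite : (ite c a b).eval s = if c.Holds s then a.eval s else b.eval s := by
  by_cases h : c.eval s = 0 <;> simp [eval, Holds, h]
open Classical in
@[simp] theorem eval_ind : (ind e).eval s = if e.Holds s then 1 else 0 := by simp [ind]

@[simp] theorem holds_le : (le a b).Holds s ↔ a.eval s ≤ b.eval s := by
  simp [Holds, le]; omega
@[simp] theorem holds_lt : (lt a b).Holds s ↔ a.eval s < b.eval s := by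
  simp [lt]
@[simp] theorem holds_not : (not a).Holds s ↔ ¬ a.Holds s := by
  by_cases h : a.eval s = 0 <;> simp [Holds, not, eval, h]
@[simp] theorem holds_and : (and a b).Holds s ↔ a.Holds s ∧ b.Holds s := by
  by_cases h : a.eval s = 0 <;> simp [Holds, and, eval, h]
@[simp] theorem holds_or : (or a b).Holds s ↔ a.Holds s ∨ b.Holds s := by
  by_cases h : a.eval s = 0 <;> simp [Holds, or, eval, h]
@[simp] theorem holds_eq : (eq a b).Holds s ↔ a.eval s = b.eval s := by
  simp [eq, le_antisymm_iff]
@[simp] theorem holds_load : (load k i).Holds s ↔ s.mem k (i.eval s) ≠ 0 := Iff.rfl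
@[simp] theorem holds_ex : (ex v L e).Holds s ↔ ∃ i < L.eval s, e.Holds (s.setReg v i) := by
  simp [Holds, ex]
@[simp] theorem holds_all : (all v L e).Holds s ↔ ∀ i < L.eval s, e.Holds (s.setReg v i) := by
  simp [all]

end RAM.Expr

/-! ### Reading an instance from the input tape -/

namespace MEFE

namespace Instance

variable (I : Instance)

/-- The input tape. -/
def input (i : ℕ) : ℕ := I.encode.getD i 0

/-- Entry `(x, t)` of the `j`-th table on the input tape. -/
def entry (j x t : ℕ) : ℕ := I.input (4 + (I.n + j * (I.n * I.m)) + (I.m * x + t))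

theorem getD_append_right' {l l' : List ℕ} {i j : ℕ} (h : i = l.length + j) :
    (l ++ l').getD i 0 = l'.getD j 0 := by
  rw [List.getD_append_right _ _ _ _ (by omega), h, Nat.add_sub_cancel_left]

theorem getD_ofFn {n : ℕ} (f : Fin n → ℕ) (i : Fin n) : (List.ofFn f).getD i 0 = f i := by
  simp [List.getD]

theorem getD_ofFn_table {n m : ℕ} (f : Fin n → Fin m → ℕ) (x : Fin n) (t : Fin m) :
    (List.ofFn fun p : Fin (n * m) => f p.divNat p.modNat).getD (m * x + t) 0 = f x t := by
  have hlt : m * x + t < n * m := (Fin.mkDivMod x t).2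
  have := getD_ofFn (fun p : Fin (n * m) => f p.divNat p.modNat) ⟨m * x + t, hlt⟩
  rw [this]
  congr 1
  · ext
    simp [Fin.divNat, Nat.mul_add_div t.pos, Nat.div_eq_of_lt t.2]
  · ext
    simp [Fin.modNat, Nat.mod_eq_of_lt t.2]

theorem input_zero : I.input 0 = I.n := by simp [input, encode]
theorem input_one : I.input 1 = I.m := by simp [input, encode]
theorem input_two : I.input 2 = I.k.num := by simp [input, encode]
theorem input_three : I.input 3 = I.k.den := by simp [input, encode]

theorem input_c (x : Fin I.n) : I.input (4 + x) = I.c x := by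
  simp only [input, encode, List.append_assoc]
  rw [getD_append_right' (j := x) (by simp), List.getD_append _ _ _ _ (by simp), getD_ofFn]

theorem mul_add_lt (x : Fin I.n) (t : Fin I.m) : I.m * x + t < I.n * I.m := (Fin.mkDivMod x t).2

theorem v_eq_entry (x : Fin I.n) (t : Fin I.m) : I.v x t = I.entry 0 x t := by
  have := I.mul_add_lt x t
  simp only [entry, input, encode, List.append_assoc]
  rw [getD_append_right' (j := I.n + (I.m * x + t)) (by simp; ring),
    getD_append_right' (j := I.m * x + t) (by simp),
    List.getD_append _ _ _ _ (by simpa using this), getD_ofFn_table]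

theorem u_eq_entry (x : Fin I.n) (t : Fin I.m) : I.u t x = I.entry 1 x t := by
  have := I.mul_add_lt x t
  simp only [entry, input, encode, List.append_assoc]
  rw [getD_append_right' (j := I.n + (I.n * I.m + (I.m * x + t))) (by simp; ring),
    getD_append_right' (j := I.n * I.m + (I.m * x + t)) (by simp),
    getD_append_right' (j := I.m * x + t) (by simp),
    List.getD_append _ _ _ _ (by simpa using this), getD_ofFn_table fun x t => I.u t x]

theorem num_eq_entry (x : Fin I.n) (t : Fin I.m) : (I.g t x).num = I.entry 2 x t := by
  have := I.mul_add_lt x t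
  simp only [entry, input, encode, List.append_assoc]
  rw [getD_append_right' (j := I.n + (I.n * I.m + (I.n * I.m + (I.m * x + t)))) (by simp; ring),
    getD_append_right' (j := I.n * I.m + (I.n * I.m + (I.m * x + t))) (by simp),
    getD_append_right' (j := I.n * I.m + (I.m * x + t)) (by simp),
    getD_append_right' (j := I.m * x + t) (by simp),
    List.getD_append _ _ _ _ (by simpa using this), getD_ofFn_table fun x t => (I.g t x).num]

theorem den_eq_entry (x : Fin I.n) (t : Fin I.m) : (I.g t x).den = I.entry 3 x t := by
  simp only [entry, input, encode, List.append_assoc]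
  rw [getD_append_right' (j := I.n + (I.n * I.m + (I.n * I.m + (I.n * I.m + (I.m * x + t)))))
      (by simp; ring),
    getD_append_right' (j := I.n * I.m + (I.n * I.m + (I.n * I.m + (I.m * x + t)))) (by simp),
    getD_append_right' (j := I.n * I.m + (I.n * I.m + (I.m * x + t))) (by simp),
    getD_append_right' (j := I.n * I.m + (I.m * x + t)) (by simp),
    getD_append_right' (j := I.m * x + t) (by simp), getD_ofFn_table fun x t => (I.g t x).den]

/-- `rank` on the input tape. -/
def rankN (x t : ℕ) : ℕ := ∑ t' ∈ Finset.range I.m,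
  if I.entry 2 x t * I.entry 3 x t' < I.entry 2 x t' * I.entry 3 x t then 1 else 0

/-- `valueIndex` on the input tape. -/
def valueIndexN (x t : ℕ) : ℕ := ∑ t' ∈ Finset.range I.m,
  if ((0 < I.entry 0 x t' ∧ I.entry 0 x t' < I.entry 0 x t) ∧
    ¬ ∃ t'' < I.m, t'' < t' ∧ I.entry 0 x t'' = I.entry 0 x t') then 1 else 0

theorem g_lt_iff (x : Fin I.n) (t t' : Fin I.m) : I.g t x < I.g t' x ↔
    I.entry 2 x t * I.entry 3 x t' < I.entry 2 x t' * I.entry 3 x t := by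
  rw [NNRat.lt_def, num_eq_entry, num_eq_entry, den_eq_entry, den_eq_entry]

theorem rank_eq (x : Fin I.n) (t : Fin I.m) : I.rank x t = I.rankN x t := by
  rw [rank, rankN, Finset.card_filter, ← Fin.sum_univ_eq_sum_range
    (fun t' => if I.entry 2 x t * I.entry 3 x t' < I.entry 2 x t' * I.entry 3 x t then 1 else 0)]
  simp only [g_lt_iff]

/-- Distinct smaller values are counted through their first occurrences: a TA is counted when no TA
of smaller index has the same value. -/
theorem valueIndex_eq (x : Fin I.n) (t : Fin I.m) : I.valueIndex x t = I.valueIndexN x t := by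
  rw [valueIndexN, ← Fin.sum_univ_eq_sum_range
    (fun t' => if ((0 < I.entry 0 x t' ∧ I.entry 0 x t' < I.entry 0 x t) ∧
    ¬ ∃ t'' < I.m, t'' < t' ∧ I.entry 0 x t'' = I.entry 0 x t') then 1 else 0),
    ← Finset.card_filter, valueIndex]
  have hfst : ∀ t' : Fin I.m, (∃ t'' < I.m, t'' < t'.val ∧ I.entry 0 x t'' = I.entry 0 x t') ↔
      ∃ t'' : Fin I.m, t'' < t' ∧ I.v x t'' = I.v x t' := fun t' => by
    simp only [Fin.exists_iff, v_eq_entry, Fin.lt_def, exists_prop]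
  symm
  refine Finset.card_bij (fun t' _ => I.v x t') (fun t' ht' => ?_) (fun t₁ h₁ t₂ h₂ e => ?_)
    fun q hq => ?_
  · simp only [Finset.mem_filter, Finset.mem_univ, true_and, ← v_eq_entry] at ht'
    exact Finset.mem_filter.mpr ⟨v_mem_positiveValues ht'.1.1.ne', ht'.1.2⟩
  · simp only [Finset.mem_filter, Finset.mem_univ, true_and, hfst, not_exists, not_and] at h₁ h₂
    rcases lt_trichotomy t₁ t₂ with hlt | he | hlt
    · exact absurd e (h₂.2 t₁ hlt)
    · exact he
    · exact absurd e.symm (h₁.2 t₂ hlt)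
  · simp only [positiveValues, Finset.mem_filter, Finset.mem_image, Finset.mem_univ,
      true_and] at hq
    obtain ⟨⟨⟨t', rfl⟩, hpos⟩, hlt⟩ := hq
    -- The least TA with the given value is its first occurrence.
    have hne : (Finset.univ.filter fun t'' => I.v x t'' = I.v x t').Nonempty := ⟨t', by simp⟩
    have hmem := Finset.min'_mem _ hne
    rw [Finset.mem_filter] at hmem
    refine ⟨_, ?_, hmem.2⟩
    simp only [Finset.mem_filter, Finset.mem_univ, true_and, hfst]
    simp only [← v_eq_entry, hmem.2]
    refine ⟨⟨hpos, hlt⟩, fun ⟨t'', h, e⟩ => absurd h (not_lt.mpr (Finset.min'_le _ _ ?_))⟩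
    simpa using e

end Instance

/-! ### Expressions for ranks, value indices and bad offers -/

namespace Code

open RAM RAM.Expr Instance

/-- The number of courses. -/
def nE : Expr := load 0 (const 0)
/-- The number of TAs. -/
def mE : Expr := load 0 (const 1)
/-- The capacity of the course in the variable `a`. -/
def cE (a : ℕ) : Expr := load 0 (add (const 4) (var a))
/-- Entry of the `j`-th table for the course in the variable `a` and the TA in the variable `b`. -/
def entryE (j a b : ℕ) : Expr := load 0 (add
  (add (const 4) (add nE (mul (const j) (mul nE mE)))) (add (mul mE (var a)) (var b)))
/-- The grade of `b` in the course `a` is less than that of `b'`. -/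
def gradeLt (a b b' : ℕ) : Expr :=
  lt (mul (entryE 2 a b) (entryE 3 a b')) (mul (entryE 2 a b') (entryE 3 a b))
/-- The rank of the TA `b` in the course `a`. -/
def rankE (a b : ℕ) : Expr := sum 14 mE (ind (gradeLt a b 14))
/-- The index of the value of the TA `b` for the course `a`. -/
def valueIndexE (a b : ℕ) : Expr := sum 12 mE (ind
  (and (and (lt (const 0) (entryE 0 a 12)) (lt (entryE 0 a 12) (entryE 0 a b)))
    (not (ex 13 mE (and (lt (var 13) (var 12)) (eq (entryE 0 a 13) (entryE 0 a 12)))))))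
/-- The index of seat `b` of the course `a`. -/
def seatE (C a b : ℕ) : Expr := add (mul (const C) (var a)) (var b)
/-- The pointer of seat `b` of the course `a`. -/
def ptrE (C a b : ℕ) : Expr := load 2 (seatE C a b)

section Eval

variable {I : Instance} {s : State} (hs : s.mem 0 = I.input) {a b b' C R : ℕ}
include hs

theorem eval_nE : nE.eval s = I.n := by simp [nE, hs, input_zero]
theorem eval_mE : mE.eval s = I.m := by simp [mE, hs, input_one]
theorem eval_cE : (cE a).eval s = I.input (4 + s.reg a) := by simp [cE, hs]
theorem eval_entryE {j : ℕ} : (entryE j a b).eval s = I.entry j (s.reg a) (s.reg b) := by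
  simp [entryE, hs, eval_nE hs, eval_mE hs, entry]
theorem holds_entryE {j : ℕ} :
    (entryE j a b).Holds s ↔ I.entry j (s.reg a) (s.reg b) ≠ 0 := by
  rw [Holds, eval_entryE hs]
theorem holds_gradeLt : (gradeLt a b b').Holds s ↔
    I.entry 2 (s.reg a) (s.reg b) * I.entry 3 (s.reg a) (s.reg b') <
      I.entry 2 (s.reg a) (s.reg b') * I.entry 3 (s.reg a) (s.reg b) := by
  simp [gradeLt, eval_entryE hs]
theorem eval_rankE (ha : a ≠ 14) (hb : b ≠ 14) :
    (rankE a b).eval s = I.rankN (s.reg a) (s.reg b) := by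
  simp [rankE, eval_mE hs, rankN, holds_gradeLt (I := I), hs, ha, hb]
theorem eval_valueIndexE (ha : a ≠ 12) (ha' : a ≠ 13) (hb : b ≠ 12) :
    (valueIndexE a b).eval s = I.valueIndexN (s.reg a) (s.reg b) := by
  simp [valueIndexE, eval_mE (I := I), valueIndexN, eval_entryE (I := I), hs, ha, hb, ha']

end Eval

@[simp] theorem eval_seatE {C a b : ℕ} {s : State} :
    (seatE C a b).eval s = C * s.reg a + s.reg b := rfl

@[simp] theorem eval_ptrE {C a b : ℕ} {s : State} :
    (ptrE C a b).eval s = s.mem 2 (C * s.reg a + s.reg b) := rfl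

/-- The offer of seat `7` of the course `6` is bad. -/
def badE (C R : ℕ) : Expr :=
  and (lt (var 7) (cE 6)) (ex 8 mE (and (eq (rankE 6 8) (ptrE C 6 7))
    (or (not (entryE 1 6 8))
    (or (not (load 3 (add (mul (const R) (seatE C 6 7)) (valueIndexE 6 8))))
    (or (ex 10 (const C) (and (lt (var 10) (var 7)) (le (rankE 6 8) (ptrE C 6 10))))
    (ex 9 nE (and (lt (entryE 1 6 8) (entryE 1 9 8))
      (ex 10 (const C) (and (lt (var 10) (cE 9)) (le (rankE 9 8) (ptrE C 9 10)))))))))))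

theorem holds_badE {I : Instance} {C R : ℕ} (hC : ∀ x, I.c x ≤ C) {s : State}
    (hs : s.mem 0 = I.input) {x : Fin I.n} (hx : s.reg 6 = x) :
    (badE C R).Holds s ↔ I.Bad C R (s.mem 3) (s.mem 2) x (s.reg 7) := by
  -- The code searches seats below the constant `C` and tests the capacity inside the loop, which
  -- keeps the loop bounds simple. As capacities are at most `C`, nothing is lost; `h₁` and `h₃`
  -- remove the extra bound.
  have h₁ : s.reg 7 < I.c x → ∀ P : ℕ → Prop,
      (∃ i < C, i < s.reg 7 ∧ P i) ↔ ∃ i < s.reg 7, P i := fun h P =>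
    ⟨fun ⟨i, _, h⟩ => ⟨i, h⟩, fun ⟨i, hi, hP⟩ => ⟨i, by have := hC x; omega, hi, hP⟩⟩
  have h₂ : ∀ P : ℕ → ℕ → Prop, (∃ y < I.n, ∃ i < C, i < I.input (4 + y) ∧ P y i) ↔
      ∃ y < I.n, ∃ i < I.input (4 + y), P y i := fun P =>
    ⟨fun ⟨y, hy, i, _, h⟩ => ⟨y, hy, i, h⟩, fun ⟨y, hy, i, hi, hP⟩ =>
      ⟨y, hy, i, by have := hC ⟨y, hy⟩; have := I.input_c ⟨y, hy⟩; simp at this; omega, hi, hP⟩⟩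
  have h₃ : ∀ (p : ℕ → Prop) (P : ℕ → ℕ → Prop),
      (∃ y < I.n, p y ∧ ∃ i < C, i < I.input (4 + y) ∧ P y i) ↔
      ∃ y < I.n, p y ∧ ∃ i < I.input (4 + y), P y i := fun p P => by
    simpa only [← exists_and_left, and_left_comm (a := p _)] using h₂ fun y i => p y ∧ P y i
  simp only [← input_c] at h₁
  simp only [badE, holds_and, holds_lt, eval_var, eval_cE hs, hx, Bad, ← input_c]
  refine and_congr_right fun h => ?_
  simp only [holds_ex, holds_and, holds_eq, holds_or, holds_not, holds_load, holds_le,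
    holds_lt, eval_add, eval_mul, eval_const, eval_var, eval_seatE, eval_ptrE,
    eval_cE (I := I), eval_mE (I := I), eval_nE (I := I),
    eval_entryE (I := I), holds_entryE (I := I), State.setReg_mem,
    State.setReg_reg, hs, hx, Fin.exists_iff, rank_eq, u_eq_entry, valueIndex_eq, exists_prop]
  simp [h₁ h, h₃, hs, hx, eval_rankE (I := I), eval_valueIndexE (I := I)]

end Code
end MEFE

/-! ### Checking a candidate matching -/

namespace MEFE.Code

open RAM RAM.Expr Instance

/-- The output entry for the TA in the variable `b`. -/
def outE (b : ℕ) : Expr := load 1 (add (var b) (const 1))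
/-- The output assigns the TA `b` to the course `a`. -/
def assignedE (b a : ℕ) : Expr := eq (outE b) (add (var a) (const 1))
/-- The grade of `b` in the course `a` is at most that of `b'`. -/
def gradeLe (a b b' : ℕ) : Expr :=
  le (mul (entryE 2 a b) (entryE 3 a b')) (mul (entryE 2 a b') (entryE 3 a b))

/-- The output is an MEFE matching. -/
def checkE : Expr :=
  and (all 8 mE (le (outE 8) nE))
  (and (all 6 nE (eq (sum 8 mE (ind (assignedE 8 6))) (cE 6)))
  (and (all 8 mE (all 6 nE (or (not (assignedE 8 6)) (entryE 1 6 8))))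
  (and (all 6 nE (le (mul (load 0 (const 2)) (cE 6)) (mul (load 0 (const 3))
    (sum 8 mE (ite (assignedE 8 6) (entryE 0 6 8) (const 0))))))
  (all 8 mE (all 11 mE (all 6 nE (or (not (and (assignedE 11 6) (gradeLe 6 11 8)))
    (le (entryE 1 6 8) (sum 9 nE (ite (assignedE 8 9) (entryE 1 9 8) (const 0)))))))))))

theorem forall_lt_iff_fin {n : ℕ} {P : ℕ → Prop} : (∀ i < n, P i) ↔ ∀ i : Fin n, P i :=
  ⟨fun h i => h i i.2, fun h i hi => h ⟨i, hi⟩⟩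

theorem outcomeCode_eq_iff {I : Instance} {o : Option (Fin I.n)} {x : Fin I.n} :
    I.outcomeCode o = x + 1 ↔ o = some x := by
  cases o <;> simp [outcomeCode, Fin.ext_iff]

/-- The form in which the machine tests a matching: the threshold condition is cleared of
denominators, and the utility of an outcome becomes a sum with at most one nonzero term. -/
theorem isMEFE_iff_of_codes {I : Instance} {O : ℕ → ℕ} {μ : I.Matching}
    (hO : ∀ t : Fin I.m, O t = I.outcomeCode (μ t)) : I.IsMEFE μ ↔
    (∀ x : Fin I.n, (∑ t : Fin I.m, if O t = x + 1 then 1 else 0) = I.c x) ∧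
    (∀ (t : Fin I.m) (x : Fin I.n), ¬ O t = x + 1 ∨ I.u t x ≠ 0) ∧
    (∀ x : Fin I.n, I.k.num * I.c x ≤
      I.k.den * ∑ t : Fin I.m, if O t = x + 1 then I.v x t else 0) ∧
    ∀ (t t' : Fin I.m) (x : Fin I.n), ¬ (O t' = x + 1 ∧ I.g t' x ≤ I.g t x) ∨
      I.u t x ≤ ∑ y : Fin I.n, if O t = y + 1 then I.u t y else 0 := by
  simp only [hO, outcomeCode_eq_iff]
  have hk : ∀ x, I.k ≤ I.avgUtil μ x ↔ I.k.num * I.c x ≤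
      I.k.den * ∑ t : Fin I.m, if μ t = some x then I.v x t else 0 := fun x => by
    rw [← Finset.sum_filter, avgUtil, le_div_iff₀ (by exact_mod_cast I.c_pos x)]
    conv_lhs => rw [← NNRat.num_div_den I.k, div_mul_eq_mul_div,
      div_le_iff₀ (by exact_mod_cast I.k.den_pos), mul_comm _ (I.k.den : ℚ≥0)]
    norm_cast
  have hut : ∀ t, (∑ y : Fin I.n, if μ t = some y then I.u t y else 0) =
      I.utility t (μ t) := fun t => by
    cases h : μ t with
    | none => simp [utility]
    | some x => simp [utility, Finset.sum_ite_eq]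
  simp only [IsMEFE, Feasible, hk, hut, assigned, Finset.card_filter, Envies, and_assoc]
  refine and_congr_right fun _ => and_congr ?_ (and_congr_right fun _ => ?_)
  · simp only [imp_iff_not_or]
  · constructor
    · intro h t t' x
      by_contra! hn
      exact h t t' ⟨x, hn.1.1, hn.1.2, by simpa [hn.1.1, utility] using hn.2⟩
    · rintro h t t' ⟨x, h₁, h₂, h₃⟩
      have := (h t t' x).resolve_left (not_not.mpr ⟨h₁, h₂⟩)
      rw [h₁] at h₃
      exact absurd h₃ (not_lt.mpr this)

theorem exists_codes_iff {I : Instance} {O : ℕ → ℕ} :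
    (∀ t : Fin I.m, O t ≤ I.n) ↔ ∃ μ : I.Matching, ∀ t : Fin I.m, O t = I.outcomeCode (μ t) := by
  constructor
  · intro h
    refine ⟨fun t => if h0 : O t = 0 then none else some ⟨O t - 1, by have := h t; omega⟩,
      fun t => ?_⟩
    dsimp only
    split_ifs with h0
    · simp [h0, outcomeCode]
    · simp only [outcomeCode]; omega
  · rintro ⟨μ, h⟩ t
    rw [h t]
    cases μ t with
    | none => simp [outcomeCode]
    | some x => simp only [outcomeCode]; omega

theorem holds_checkE {I : Instance} {s : State} (hs : s.mem 0 = I.input) :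
    checkE.Holds s ↔ ∃ μ : I.Matching, I.IsMEFE μ ∧
      ∀ t : Fin I.m, s.mem 1 (t + 1) = I.outcomeCode (μ t) := by
  have key : checkE.Holds s ↔ (∀ t : Fin I.m, s.mem 1 (t + 1) ≤ I.n) ∧
      (∀ x : Fin I.n, (∑ t : Fin I.m, if s.mem 1 (t + 1) = x + 1 then 1 else 0) = I.c x) ∧
      (∀ (t : Fin I.m) (x : Fin I.n), ¬ s.mem 1 (t + 1) = x + 1 ∨ I.u t x ≠ 0) ∧
      (∀ x : Fin I.n, I.k.num * I.c x ≤
        I.k.den * ∑ t : Fin I.m, if s.mem 1 (t + 1) = x + 1 then I.v x t else 0) ∧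
      ∀ (t t' : Fin I.m) (x : Fin I.n),
        ¬ (s.mem 1 (t' + 1) = x + 1 ∧ I.g t' x ≤ I.g t x) ∨
        I.u t x ≤ ∑ y : Fin I.n, if s.mem 1 (t + 1) = y + 1 then I.u t y else 0 := by
    simp only [checkE, outE, assignedE, gradeLe, holds_and, holds_all, holds_eq, holds_or,
      holds_not, holds_le, eval_add, eval_mul, eval_const, eval_var, eval_load, eval_sum,
      eval_ite, eval_ind, eval_cE (I := I), eval_mE (I := I), eval_nE (I := I),
      eval_entryE (I := I), holds_entryE (I := I), State.setReg_mem, State.setReg_reg, hs,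
      input_two, input_three]
    simp [forall_lt_iff_fin, Finset.sum_range, ← u_eq_entry, ← v_eq_entry, ← g_lt_iff, input_c,
      -Finset.sum_boole]
  rw [key, exists_codes_iff (O := fun t => s.mem 1 (t + 1))]
  constructor
  · rintro ⟨⟨μ, hμ⟩, h⟩
    exact ⟨μ, (isMEFE_iff_of_codes (O := fun t => s.mem 1 (t + 1)) hμ).mpr h, hμ⟩
  · rintro ⟨μ, h, hμ⟩
    exact ⟨⟨μ, hμ⟩, (isMEFE_iff_of_codes (O := fun t => s.mem 1 (t + 1)) hμ).mp h⟩

/-! ### The search over all guesses -/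

/-- Advance the pointers of all seats once. -/
def roundC (C R : ℕ) : Cmd := .forLt 6 nE (.forLt 7 (const C)
  (.store 2 (seatE C 6 7) (add (ptrE C 6 7) (ind (badE C R)))))

theorem sem_roundC {I : Instance} {C R : ℕ} (hC : ∀ x, I.c x ≤ C) {s : State}
    (hs : s.mem 0 = I.input) : ((roundC C R).sem s).mem 2 = I.round C R (s.mem 3) (s.mem 2) ∧
      ∀ b, b ≠ 2 → ((roundC C R).sem s).mem b = s.mem b := by
  simp only [roundC, Cmd.sem, eval_nE hs, eval_const, Instance.round]
  refine iterN_rel (P := fun (a : State) ρ => a.mem 2 = ρ ∧ ∀ b, b ≠ 2 → a.mem b = s.mem b) I.n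
    (fun x hx a ρ ha => ?_) ⟨rfl, fun _ _ => rfl⟩
  refine (iterN_rel (P := fun (a : State) ρ => a.reg 6 = x ∧ a.mem 2 = ρ ∧
    ∀ b, b ≠ 2 → a.mem b = s.mem b) C (fun i hi a ρ ha => ?_) ?_).2
  swap
  · exact ⟨by simp, ha⟩
  obtain ⟨h6, rfl, ha⟩ := ha
  refine ⟨by simpa using h6, ?_, fun b hb => by simp [State.setMem_mem, hb, ha b hb]⟩
  have hb := holds_badE (R := R) hC (s := a.setReg 7 i) (by simp [ha 0 (by simp), hs])
    (x := ⟨x, hx⟩) (by simpa using h6)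
  simp only [State.setReg_mem, State.setReg_reg, ha 3 (by simp), if_true] at hb
  have he : (∃ y : Fin I.n, y.val = x ∧ I.Bad C R (s.mem 3) (a.mem 2) y i) ↔
      I.Bad C R (s.mem 3) (a.mem 2) ⟨x, hx⟩ i :=
    ⟨fun ⟨y, hy, h⟩ => by rwa [show y = ⟨x, hx⟩ from Fin.ext hy] at h, fun h => ⟨_, rfl, h⟩⟩
  simp only [State.setMem_mem, eval_seatE, eval_ptrE, eval_add, eval_ind, if_true]
  by_cases h : I.Bad C R (s.mem 3) (a.mem 2) ⟨x, hx⟩ i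
  · rw [bump, if_pos (he.mpr h), if_pos (hb.mpr h)]
    simp [h6]
  · rw [bump, if_neg (mt he.mp h), if_neg (mt hb.mp h)]
    simp

/-- The number of bits of a guess. -/
def bitsE (C R : ℕ) : Expr := mul (const R) (mul (const C) nE)

/-- Write the bits of the variable `3` into bank `3`. -/
def guessC (C R : ℕ) : Cmd := .seq (.assign 4 (var 3)) (.forLt 5 (bitsE C R) (.seq
  (.store 3 (var 5) (sub (var 4) (add (half (var 4)) (half (var 4))))) (.assign 4 (half (var 4)))))

theorem sem_guessC {I : Instance} {C R : ℕ} {s : State} (hs : s.mem 0 = I.input) :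
    (∀ j < R * (C * I.n), ((guessC C R).sem s).mem 3 j = s.reg 3 / 2 ^ j % 2) ∧
      ∀ b, b ≠ 3 → ((guessC C R).sem s).mem b = s.mem b := by
  have hn : (bitsE C R).eval (s.setReg 4 (s.reg 3)) = R * (C * I.n) := by
    simp [bitsE, eval_nE (I := I), hs]
  simp only [guessC, Cmd.sem, eval_var, hn]
  refine (iterN_inv (P := fun k (a : State) => a.reg 4 = s.reg 3 / 2 ^ k ∧
    (∀ j < k, a.mem 3 j = s.reg 3 / 2 ^ j % 2) ∧ ∀ b, b ≠ 3 → a.mem b = s.mem b) _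
    (fun k _ a ha => ?_) (by simp)).2
  obtain ⟨h₁, h₂, h₃⟩ := ha
  refine ⟨by simp [h₁, Nat.div_div_eq_div_mul, pow_succ], fun j hj => ?_,
    fun b hb => by simp [State.setMem_mem, hb, h₃ b hb]⟩
  simp only [State.setMem_mem, State.setReg_mem, if_true, eval_var, State.setReg_reg,
    Function.update_apply, eval_sub, eval_add, eval_half]
  by_cases h : j = k
  -- Subtracting twice its half from a number leaves its parity.
  · simp [h, h₁]; omega
  · simpa [h] using h₂ j (by omega)

/-- Reset all pointers. -/
def resetC (C : ℕ) : Cmd := .forLt 5 (mul (const C) nE) (.store 2 (var 5) (const 0))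

theorem sem_resetC {I : Instance} {C : ℕ} {s : State} (hs : s.mem 0 = I.input) :
    (∀ j < C * I.n, ((resetC C).sem s).mem 2 j = 0) ∧
      ∀ b, b ≠ 2 → ((resetC C).sem s).mem b = s.mem b := by
  simp only [resetC, Cmd.sem, eval_mul, eval_const, eval_nE hs]
  refine iterN_inv (P := fun k (a : State) => (∀ j < k, a.mem 2 j = 0) ∧ ∀ b, b ≠ 2 → a.mem b = s.mem b) _
    (fun k _ a ha => ?_) (by simp)
  refine ⟨fun j hj => ?_, fun b hb => by simp [State.setMem_mem, hb, ha.2 b hb]⟩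
  simp only [State.setMem_mem, State.setReg_mem, if_true, eval_var, State.setReg_reg,
    Function.update_apply]
  split_ifs with h
  · rfl
  · exact ha.1 j (by omega)

/-- Advance the pointers until none moves. -/
def roundsC (C R : ℕ) : Cmd :=
  .forLt 5 (add (mul (const C) (mul nE mE)) (const 1)) (roundC C R)

theorem sem_roundsC {I : Instance} {C R : ℕ} (hC : ∀ x, I.c x ≤ C) {s : State}
    (hs : s.mem 0 = I.input) : ((roundsC C R).sem s).mem 2 =
        iterN (fun _ => I.round C R (s.mem 3)) (C * (I.n * I.m) + 1) (s.mem 2) ∧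
      ∀ b, b ≠ 2 → ((roundsC C R).sem s).mem b = s.mem b := by
  simp only [roundsC, Cmd.sem, eval_add, eval_mul, eval_const, eval_nE hs, eval_mE hs]
  refine iterN_rel (P := fun (a : State) ρ => a.mem 2 = ρ ∧ ∀ b, b ≠ 2 → a.mem b = s.mem b) _
    (fun x hx a ρ ha => ?_) ⟨rfl, fun _ _ => rfl⟩
  obtain ⟨rfl, ha⟩ := ha
  have := sem_roundC (R := R) hC (s := a.setReg 5 x) (by simp [ha 0 (by simp), hs])
  simp only [State.setReg_mem, ha 3 (by simp)] at this
  exact ⟨this.1, fun b hb => (this.2 b hb).trans (ha b hb)⟩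

/-- Write the matching given by the pointers to the output. -/
def writeC (C : ℕ) : Cmd := .forLt 8 mE (.store 1 (add (var 8) (const 1))
  (sum 6 nE (sum 7 (const C) (ite (and (lt (var 7) (cE 6)) (eq (rankE 6 8) (ptrE C 6 7)))
    (add (var 6) (const 1)) (const 0)))))

theorem sem_writeC {I : Instance} {C : ℕ} {s : State} (hs : s.mem 0 = I.input) :
    (∀ t : Fin I.m, ((writeC C).sem s).mem 1 (t + 1) =
      ∑ x : Fin I.n, ∑ i ∈ Finset.range C,
        if i < I.c x ∧ I.rank x t = s.mem 2 (C * x + i) then x.val + 1 else 0) ∧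
      ∀ b, b ≠ 1 → ((writeC C).sem s).mem b = s.mem b := by
  have key : ((∀ t < I.m, ((writeC C).sem s).mem 1 (t + 1) =
      ∑ x ∈ Finset.range I.n, ∑ i ∈ Finset.range C,
        if i < I.input (4 + x) ∧ I.rankN x t = s.mem 2 (C * x + i) then x + 1 else 0) ∧
      ∀ b, b ≠ 1 → ((writeC C).sem s).mem b = s.mem b) := by
    simp only [writeC, Cmd.sem, eval_mE hs]
    refine iterN_inv (P := fun k (a : State) => (∀ t < k, a.mem 1 (t + 1) =
        ∑ x ∈ Finset.range I.n, ∑ i ∈ Finset.range C,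
        if i < I.input (4 + x) ∧ I.rankN x t = s.mem 2 (C * x + i) then x + 1 else 0) ∧
        ∀ b, b ≠ 1 → a.mem b = s.mem b) _ (fun k _ a ha => ?_) (by simp)
    have h0 : a.mem 0 = I.input := (ha.2 0 (by simp)).trans hs
    refine ⟨fun j hj => ?_, fun b hb => by simp [State.setMem_mem, hb, ha.2 b hb]⟩
    simp only [State.setMem_mem, if_true, Function.update_apply]
    split_ifs with h
    · simp at h
      simp [eval_nE (I := I), h0, eval_cE (I := I), eval_rankE (I := I), h, ha.2 2]
    · simp at h
      exact ha.1 j (by omega)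
  refine ⟨fun t => (key.1 t t.2).trans ?_, key.2⟩
  simp only [Finset.sum_range (n := I.n), input_c, rank_eq]

/-- Try the guess in the variable `3`. -/
def tryC (C R : ℕ) : Cmd := .seq (guessC C R) (.seq (resetC C) (.seq (roundsC C R)
  (.seq (writeC C) (.store 1 (const 0) (ind checkE)))))

/-- Success is sound for every guess, because it is reported only after the check. Failure excludes
just those MEFE matchings whose seating is described by the bits of this guess; for one of these,
the pointers would have ended in an MEFE matching. -/
theorem sem_tryC {I : Instance} {C R : ℕ} (hI : Restricted C R I) {s : State}
    (hs : s.mem 0 = I.input) : ((tryC C R).sem s).mem 0 = I.input ∧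
    ((((tryC C R).sem s).mem 1 0 = 1 ∧ ∃ μ : I.Matching, I.IsMEFE μ ∧
        ∀ t : Fin I.m, ((tryC C R).sem s).mem 1 (t + 1) = I.outcomeCode (μ t)) ∨
      ((tryC C R).sem s).mem 1 0 = 0 ∧ ¬ ∃ (μ : I.Matching) (r : Fin I.n → ℕ → ℕ),
        I.IsMEFE μ ∧ I.IsSeating μ r ∧ Marks C R (fun j => s.reg 3 / 2 ^ j % 2) μ r) := by
  obtain ⟨g₁, g₂⟩ := sem_guessC (C := C) (R := R) hs
  simp only [tryC, Cmd.sem]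
  generalize (guessC C R).sem s = s₁ at *
  have h₁ : s₁.mem 0 = I.input := (g₂ 0 (by simp)).trans hs
  obtain ⟨z₁, z₂⟩ := sem_resetC (C := C) h₁
  generalize (resetC C).sem s₁ = s₂ at *
  have h₂ : s₂.mem 0 = I.input := (z₂ 0 (by simp)).trans h₁
  obtain ⟨r₁, r₂⟩ := sem_roundsC (R := R) hI.1 h₂
  generalize (roundsC C R).sem s₂ = s₃ at *
  have h₃ : s₃.mem 0 = I.input := (r₂ 0 (by simp)).trans h₂
  obtain ⟨w₁, w₂⟩ := sem_writeC (C := C) h₃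
  generalize (writeC C).sem s₃ = s₄ at *
  have h₄ : s₄.mem 0 = I.input := (w₂ 0 (by simp)).trans h₃
  have hc := holds_checkE h₄
  refine ⟨by simp [State.setMem_mem, h₄], ?_⟩
  simp only [State.setMem_mem, if_true, eval_const, eval_ind, Function.update_apply]
  by_cases h : checkE.Holds s₄
  · left
    simpa [h] using hc.mp h
  · right
    refine ⟨by simp [h], fun ⟨μ, r, hμ, hr, hm⟩ => h (hc.mpr ?_)⟩
    have hlt : ∀ x : Fin I.n, ∀ i < I.c x, C * x + i < C * I.n := fun x i hi => by
      have := hI.1 x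
      have := Nat.mul_le_mul_left C (Nat.succ_le_of_lt x.2)
      rw [Nat.mul_succ] at this
      omega
    -- Only the first `R * (C * I.n)` cells of bank `3` hold the guess, but every cell that `Marks`
    -- inspects is among them.
    have hm' : Marks C R (s₂.mem 3) μ r := fun x i hi t h₁ h₂ q hq => by
      rw [z₂ 3 (by simp), g₁]
      · exact hm x i hi t h₁ h₂ q hq
      · have := Nat.mul_le_mul_left R (Nat.succ_le_of_lt (hlt x i hi))
        rw [Nat.mul_succ] at this
        omega
    have hf := isFinal_rounds hI hr hμ hm' (ρ := s₂.mem 2) fun x i hi => z₁ _ (hlt x i hi)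
    rw [← r₁] at hf
    exact ⟨_, hf.isMEFE, fun t => (w₁ t).trans (hf.sum_eq_outcomeCode t)⟩

/-- The number whose bits are the indicator of the pairs of a seat and the value index of its TA;
value indices are below `R`, so the seats use disjoint blocks of `R` bits. -/
theorem exists_guess {I : Instance} {C R : ℕ} (hI : Restricted C R I) {μ : I.Matching}
    (hμ : I.IsMEFE μ) : ∃ e < 2 ^ (R * (C * I.n)), ∃ r : Fin I.n → ℕ → ℕ,
      I.IsSeating μ r ∧ Marks C R (fun j => e / 2 ^ j % 2) μ r := by
  classical
  obtain ⟨r, hr⟩ := exists_isSeating hI.2.2.1 hμ.1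
  let b : Fin (R * (C * I.n)) → Bool := fun j => decide (∃ x : Fin I.n, ∃ i < I.c x, ∃ t,
    μ t = some x ∧ I.rank x t = r x i ∧ j.val = R * (C * x + i) + I.valueIndex x t)
  refine ⟨Nat.ofBits b, Nat.ofBits_lt_two_pow b, r, hr, fun x i hi t ht hrt q hq => ?_⟩
  have hv : ∀ t x, μ t = some x → I.valueIndex x t < R := fun t x h =>
    (valueIndex_lt fun h0 => hμ.1.2 t x h ((I.v_eq_zero_iff x t).mp h0)).trans_le (hI.2.1 x)
  have hlt : R * (C * x + i) + q < R * (C * I.n) := by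
    have := hI.1 x
    have h₁ := Nat.mul_le_mul_left C (Nat.succ_le_of_lt x.2)
    rw [Nat.mul_succ] at h₁
    have h₂ := Nat.mul_le_mul_left R (show C * x + i + 1 ≤ C * I.n by omega)
    rw [Nat.mul_succ] at h₂
    omega
  have hb := Nat.testBit_ofBits_lt b _ hlt
  rw [Nat.testBit_eq_decide_div_mod_eq] at hb
  have : Nat.ofBits b / 2 ^ (R * (C * x + i) + q) % 2 ≠ 0 ↔ b ⟨_, hlt⟩ = true := by
    rw [← hb, decide_eq_true_iff]; omega
  refine this.trans ?_
  simp only [b, decide_eq_true_iff]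
  constructor
  · rintro ⟨x', i', hi', t', ht', hr', e⟩
    -- A set bit comes from some seat; its position determines the seat and the index, and the rank
    -- on that seat determines the TA.
    obtain ⟨e₁, e₂⟩ := seat_index_inj hq (hv t' x' ht') e
    obtain ⟨e₃, rfl⟩ := seat_index_inj (hi.trans_le (hI.1 x)) (hi'.trans_le (hI.1 x')) e₁
    obtain rfl := Fin.ext e₃
    rw [e₂, hI.2.2.1.rank_injective x (hr'.trans hrt.symm)]
  · rintro rfl
    exact ⟨x, i, hi, t, ht, hrt, rfl⟩

/-- The number of guesses is computed into the variable `15`. -/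
def countC (C R : ℕ) : Cmd :=
  .seq (.assign 15 (const 1)) (.forLt 5 (bitsE C R) (.assign 15 (add (var 15) (var 15))))

theorem sem_countC {I : Instance} {C R : ℕ} {s : State} (hs : s.mem 0 = I.input) :
    ((countC C R).sem s).reg 15 = 2 ^ (R * (C * I.n)) ∧ ((countC C R).sem s).mem = s.mem := by
  have hn : (bitsE C R).eval (s.setReg 15 1) = R * (C * I.n) := by
    simp [bitsE, eval_nE (I := I), hs]
  simp only [countC, Cmd.sem, eval_const, hn]
  refine iterN_inv (P := fun k (a : State) => a.reg 15 = 2 ^ k ∧ a.mem = s.mem) _ (fun k _ a ha => ?_)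
    (by simp)
  exact ⟨by simp [ha.1, pow_succ]; ring, by simp [ha.2]⟩

/-- Try the guess in the variable `3` unless a matching has been found. -/
def stepC (C R : ℕ) : Cmd := .ite (load 1 (const 0)) .skip (tryC C R)

/-- The algorithm for at least one course. -/
def searchC (C R : ℕ) : Cmd := .seq (countC C R) (.forLt 3 (var 15) (stepC C R))

/-- The algorithm. -/
def mainC (C R : ℕ) : Cmd := .ite nE (searchC C R) (.store 1 (const 0) (const 1))

/-- Loop invariant: either a verified matching stands in the output and is no longer touched, or
every guess tried so far describes no MEFE matching. After all guesses, `exists_guess` turns the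
second case into nonexistence. -/
theorem sem_searchC {I : Instance} {C R : ℕ} (hI : Restricted C R I) {s : State}
    (hs : s.mem 0 = I.input) (h0 : s.mem 1 0 = 0) :
    I.CorrectAnswer (((searchC C R).sem s).mem 1) := by
  obtain ⟨c₁, c₂⟩ := sem_countC (C := C) (R := R) hs
  simp only [searchC, Cmd.sem, eval_var]
  generalize (countC C R).sem s = s₁ at *
  rw [c₁]
  have := iterN_inv (f := fun i s => (stepC C R).sem (s.setReg 3 i)) (a := s₁)
    (P := fun k (a : State) => a.mem 0 = I.input ∧ ((a.mem 1 0 = 1 ∧ ∃ μ : I.Matching, I.IsMEFE μ ∧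
        ∀ t : Fin I.m, a.mem 1 (t + 1) = I.outcomeCode (μ t)) ∨
      a.mem 1 0 = 0 ∧ ∀ e < k, ¬ ∃ (μ : I.Matching) (r : Fin I.n → ℕ → ℕ),
        I.IsMEFE μ ∧ I.IsSeating μ r ∧ Marks C R (fun j => e / 2 ^ j % 2) μ r))
    (2 ^ (R * (C * I.n))) (fun k _ a ha => ?_) (by simp [c₂, hs, h0])
  · refine this.2.imp id fun ⟨h, h'⟩ => ⟨h, fun ⟨μ, hμ⟩ => ?_⟩
    obtain ⟨e, he, r, hr⟩ := exists_guess hI hμ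
    exact h' e he ⟨μ, r, hμ, hr⟩
  · obtain ⟨ha, h | h⟩ := ha
    · refine ⟨by simp [stepC, Cmd.sem, h.1, ha], .inl ?_⟩
      simpa [stepC, Cmd.sem, h.1] using h.2
    · have := sem_tryC hI (s := a.setReg 3 k) ha
      simp only [stepC, Cmd.sem, eval_load, eval_const, State.setReg_mem, h.1, if_true]
      refine ⟨this.1, this.2.imp id fun h' => ⟨h'.1, fun e he => ?_⟩⟩
      rcases Nat.lt_succ_iff_lt_or_eq.mp he with hlt | rfl
      · exact h.2 e hlt
      · simpa using h'.2

theorem sem_mainC {I : Instance} {C R : ℕ} (hI : Restricted C R I) {s : State}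
    (hs : s.mem 0 = I.input) (h0 : ∀ i, s.mem 1 i = 0) :
    I.CorrectAnswer (((mainC C R).sem s).mem 1) := by
  simp only [mainC, Cmd.sem, eval_nE hs]
  split_ifs with hn
  -- Without courses, leaving every TA unassigned is MEFE and the zero-filled output bank already
  -- encodes it. This case avoids loops over the TAs, whose number is not bounded by the input
  -- length when the tables are empty.
  · have : IsEmpty (Fin I.n) := by rw [hn]; infer_instance
    refine .inl ⟨by simp [State.setMem_mem], fun _ => none, ⟨⟨this.elim, by simp⟩, this.elim, ?_⟩,
      fun t => by simp [State.setMem_mem, h0, outcomeCode]⟩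
    rintro t t' ⟨x, -⟩
    exact this.elim x
  · exact sem_searchC hI hs (h0 0)

end MEFE.Code

/-! ### The running time of the search -/

namespace MEFE.Code

open RAM RAM.Expr Instance

/-- `B` bounds all quantities that determine the running time. -/
structure Bounds (I : Instance) (C R B : ℕ) : Prop where
  size_input : ∀ i, Nat.size (I.input i) ≤ B
  three_le : 3 ≤ B
  n_le : I.n ≤ B
  m_le : I.m ≤ B
  C_le : C ≤ B
  R_le : R ≤ B
  seats_le : C * I.n ≤ B
  bits_le : R * (C * I.n) ≤ B
  rounds_le : C * (I.n * I.m) + 1 ≤ B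

theorem size_le_self (k : ℕ) : Nat.size k ≤ k := Nat.size_le.mpr Nat.lt_two_pow_self

theorem safe_sum_mE {I : Instance} {v B : ℕ} {e : Expr} (hm : I.m ≤ B) (he : e.Safe I.input B) :
    (sum v mE e).Safe I.input B :=
  ⟨fun _ hσ => (eval_mE hσ).le.trans hm, trivial, he⟩

theorem safe_sum_nE {I : Instance} {v B : ℕ} {e : Expr} (hn : I.n ≤ B) (he : e.Safe I.input B) :
    (sum v nE e).Safe I.input B :=
  ⟨fun _ hσ => (eval_nE hσ).le.trans hn, trivial, he⟩

theorem safe_mul_load {I : Instance} {B : ℕ} {i e : Expr} (h : ∀ i, Nat.size (I.input i) ≤ B)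
    (hi : i.Safe I.input B) (he : e.Safe I.input B) : (mul (load 0 i) e).Safe I.input B :=
  ⟨fun σ hσ => by rw [eval_load, hσ]; exact h _, hi, he⟩

theorem safe_mul_const {M : ℕ → ℕ} {B k : ℕ} {e : Expr} (hk : k ≤ B) (he : e.Safe M B) :
    (mul (const k) e).Safe M B :=
  ⟨fun _ _ => (size_le_self k).trans hk, trivial, he⟩

section Safe

variable {M : ℕ → ℕ} {B : ℕ} {a b e L : Expr} {v : ℕ}

theorem safe_not (ha : a.Safe M B) : (not a).Safe M B := ⟨ha, trivial, trivial⟩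
theorem safe_and (ha : a.Safe M B) (hb : b.Safe M B) : (and a b).Safe M B := ⟨ha, hb, trivial⟩
theorem safe_or (ha : a.Safe M B) (hb : b.Safe M B) : (or a b).Safe M B := ⟨ha, trivial, hb⟩
theorem safe_le (ha : a.Safe M B) (hb : b.Safe M B) : (le a b).Safe M B := ⟨trivial, ha, hb⟩
theorem safe_lt (ha : a.Safe M B) (hb : b.Safe M B) : (lt a b).Safe M B :=
  safe_le ⟨ha, trivial⟩ hb
theorem safe_eq (ha : a.Safe M B) (hb : b.Safe M B) : (eq a b).Safe M B :=
  safe_and (safe_le ha hb) (safe_le hb ha)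
theorem safe_ind (ha : a.Safe M B) : (ind a).Safe M B := ⟨ha, trivial, trivial⟩
theorem safe_all (h : (sum v L (not e)).Safe M B) : (all v L e).Safe M B := safe_not h
theorem safe_ex (h : (sum v L e).Safe M B) : (ex v L e).Safe M B := h
theorem safe_cE (a : ℕ) : (cE a).Safe M B := ⟨trivial, trivial⟩
theorem safe_assignedE (a b : ℕ) : (assignedE a b).Safe M B :=
  safe_eq ⟨trivial, trivial⟩ ⟨trivial, trivial⟩

end Safe

section Bounds

variable {I : Instance} {C R B : ℕ} (h : Bounds I C R B)
include h

theorem safe_entryE {j : ℕ} (hj : j ≤ 3) (a b : ℕ) : (entryE j a b).Safe I.input B :=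
  ⟨⟨trivial, trivial, safe_mul_const (hj.trans h.three_le)
    (safe_mul_load h.size_input trivial trivial)⟩, safe_mul_load h.size_input trivial trivial,
    trivial⟩

theorem safe_gradeLt (a b b' : ℕ) : (gradeLt a b b').Safe I.input B :=
  safe_lt (safe_mul_load h.size_input (safe_entryE h (by simp) _ _) (safe_entryE h le_rfl _ _))
    (safe_mul_load h.size_input (safe_entryE h (by simp) _ _) (safe_entryE h le_rfl _ _))

theorem safe_gradeLe (a b b' : ℕ) : (gradeLe a b b').Safe I.input B :=
  safe_le (safe_mul_load h.size_input (safe_entryE h (by simp) _ _) (safe_entryE h le_rfl _ _))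
    (safe_mul_load h.size_input (safe_entryE h (by simp) _ _) (safe_entryE h le_rfl _ _))

theorem safe_rankE (a b : ℕ) : (rankE a b).Safe I.input B :=
  safe_sum_mE h.m_le (safe_ind (safe_gradeLt h _ _ _))

theorem safe_valueIndexE (a b : ℕ) : (valueIndexE a b).Safe I.input B := by
  have h0 := fun a b => safe_entryE h (Nat.zero_le 3) a b
  exact safe_sum_mE h.m_le (safe_ind (safe_and (safe_and (safe_lt trivial (h0 _ _))
    (safe_lt (h0 _ _) (h0 _ _))) (safe_not (safe_ex (safe_sum_mE h.m_le
      (safe_and (safe_lt trivial trivial) (safe_eq (h0 _ _) (h0 _ _))))))))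

theorem safe_seatE (a b : ℕ) : (seatE C a b).Safe I.input B :=
  ⟨safe_mul_const h.C_le trivial, trivial⟩

theorem safe_ptrE (a b : ℕ) : (ptrE C a b).Safe I.input B := safe_seatE h a b

theorem safe_sum_C {v : ℕ} {e : Expr} (he : e.Safe I.input B) :
    (sum v (const C) e).Safe I.input B := ⟨fun _ _ => h.C_le, trivial, he⟩

theorem safe_badE : (badE C R).Safe I.input B :=
  safe_and (safe_lt trivial (safe_cE _)) (safe_ex (safe_sum_mE h.m_le
    (safe_and (safe_eq (safe_rankE h _ _) (safe_ptrE h _ _))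
      (safe_or (safe_not (safe_entryE h (by simp) _ _))
      (safe_or (safe_not ⟨safe_mul_const h.R_le (safe_seatE h _ _), safe_valueIndexE h _ _⟩)
      (safe_or (safe_ex (safe_sum_C h (safe_and (safe_lt trivial trivial)
        (safe_le (safe_rankE h _ _) (safe_ptrE h _ _)))))
      (safe_ex (safe_sum_nE h.n_le (safe_and
        (safe_lt (safe_entryE h (by simp) _ _) (safe_entryE h (by simp) _ _))
        (safe_ex (safe_sum_C h (safe_and (safe_lt trivial (safe_cE _))
          (safe_le (safe_rankE h _ _) (safe_ptrE h _ _))))))))))))))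

theorem safe_checkE : checkE.Safe I.input B :=
  safe_and (safe_all (safe_sum_mE h.m_le (safe_not (safe_le ⟨trivial, trivial⟩ trivial))))
  (safe_and (safe_all (safe_sum_nE h.n_le (safe_not (safe_eq
    (safe_sum_mE h.m_le (safe_ind (safe_assignedE _ _))) (safe_cE _)))))
  (safe_and (safe_all (safe_sum_mE h.m_le (safe_not (safe_all (safe_sum_nE h.n_le (safe_not
    (safe_or (safe_not (safe_assignedE _ _)) (safe_entryE h (by simp) _ _))))))))
  (safe_and (safe_all (safe_sum_nE h.n_le (safe_not (safe_le
    (safe_mul_load h.size_input trivial (safe_cE _))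
    (safe_mul_load h.size_input trivial (safe_sum_mE h.m_le
      ⟨safe_assignedE _ _, safe_entryE h (by simp) _ _, trivial⟩))))))
  (safe_all (safe_sum_mE h.m_le (safe_not (safe_all (safe_sum_mE h.m_le (safe_not (safe_all
    (safe_sum_nE h.n_le (safe_not (safe_or
      (safe_not (safe_and (safe_assignedE _ _) (safe_gradeLe h _ _ _)))
      (safe_le (safe_entryE h (by simp) _ _) (safe_sum_nE h.n_le
        ⟨safe_assignedE _ _, safe_entryE h (by simp) _ _, trivial⟩)))))))))))))))

theorem safe_bitsE : (bitsE C R).Safe I.input B :=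
  safe_mul_const h.R_le (safe_mul_const h.C_le trivial)

theorem eval_bitsE_le (σ : State) (hσ : σ.mem 0 = I.input) : (bitsE C R).eval σ ≤ B := by
  simpa [bitsE, eval_nE hσ] using h.bits_le

theorem safe_countC : (countC C R).Safe I.input B :=
  ⟨trivial, eval_bitsE_le h, safe_bitsE h, trivial, trivial⟩

theorem safe_roundC : (roundC C R).Safe I.input B :=
  ⟨fun _ hσ => (eval_nE hσ).le.trans h.n_le, trivial, fun _ _ => h.C_le, trivial, by simp,
    safe_seatE h _ _, safe_ptrE h _ _, safe_ind (safe_badE h)⟩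

theorem safe_tryC : (tryC C R).Safe I.input B := by
  refine ⟨⟨trivial, eval_bitsE_le h, safe_bitsE h, ⟨by simp, trivial, trivial, trivial, trivial⟩,
    trivial⟩, ⟨fun σ hσ => ?_, safe_mul_const h.C_le trivial, by simp, trivial, trivial⟩,
    ⟨fun σ hσ => ?_, ⟨safe_mul_const h.C_le (safe_mul_load h.size_input trivial trivial), trivial⟩,
      safe_roundC h⟩,
    ⟨fun σ hσ => (eval_mE hσ).le.trans h.m_le, trivial, by simp, ⟨trivial, trivial⟩,
      safe_sum_nE h.n_le (safe_sum_C h ⟨safe_and (safe_lt trivial (safe_cE _))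
        (safe_eq (safe_rankE h _ _) (safe_ptrE h _ _)), ⟨trivial, trivial⟩, trivial⟩)⟩,
    by simp, trivial, safe_ind (safe_checkE h)⟩
  · simpa [eval_nE hσ] using h.seats_le
  · simpa [eval_nE hσ, eval_mE hσ] using h.rounds_le

theorem safe_stepC : (stepC C R).Safe I.input B := ⟨trivial, trivial, safe_tryC h⟩

end Bounds

/-- The loop over the guesses has an exponential bound held in a register, so the whole search is
not covered by `Safe`. Its passes are counted by hand, and `exists_cost_le` is used for the counting
phase and for a single pass. -/
theorem exists_searchC_cost_le (C R : ℕ) : ∃ F : Polynomial ℕ, ∀ (I : Instance) (B : ℕ),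
    Bounds I C R B → ∀ σ : State, σ.mem 0 = I.input →
      (searchC C R).cost σ ≤ 2 ^ (R * (C * I.n)) * F.eval B := by
  obtain ⟨F, hF⟩ := (countC C R).exists_cost_le
  obtain ⟨G, hG⟩ := (stepC C R).exists_cost_le
  refine ⟨F + (G + 6) + 4, fun I B h σ hσ => ?_⟩
  have h₁ := hF _ B (safe_countC h) σ hσ
  obtain ⟨c₁, c₂⟩ := sem_countC (C := C) (R := R) hσ
  simp only [searchC, Cmd.cost, eval_var, Expr.cost]
  generalize (countC C R).sem σ = σ₁ at *
  rw [c₁]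
  have h₂ := Finset.sum_le_card_nsmul (Finset.range (2 ^ (R * (C * I.n))))
    (fun i => (stepC C R).cost ((iterN (fun i s => (stepC C R).sem (s.setReg 3 i)) i σ₁).setReg 3 i)
      + 6) (G.eval B + 6) fun i _ => by
    have := hG _ B (safe_stepC h)
      ((iterN (fun i s => (stepC C R).sem (s.setReg 3 i)) i σ₁).setReg 3 i)
      (iterN_inv (P := fun _ (s : State) => s.mem 0 = I.input) _
        (fun i _ s hs => (safe_stepC h).sem_mem_zero (by exact hs)) (by rw [c₂, hσ]))
    omega
  simp only [Finset.card_range, smul_eq_mul] at h₂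
  -- The cost outside the loop is absorbed into the factor `2 ^ (R * (C * I.n))`, which is at least
  -- `1`.
  have h₃ : F.eval B + 4 ≤ 2 ^ (R * (C * I.n)) * (F.eval B + 4) :=
    Nat.le_mul_of_pos_left _ (by positivity)
  simp only [Polynomial.eval_add, Polynomial.eval_ofNat]
  rw [show F.eval B + (G.eval B + 6) + 4 = (F.eval B + 4) + (G.eval B + 6) by ring, mul_add]
  omega

theorem length_le_inputSize (w : List ℕ) : w.length ≤ inputSize w := by
  induction w with
  | nil => simp
  | cons a w ih => simp only [inputSize, List.map_cons, List.sum_cons, List.length_cons] at *; omega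

theorem size_getD_le_inputSize (w : List ℕ) (i : ℕ) : Nat.size (w.getD i 0) ≤ inputSize w := by
  induction w generalizing i with
  | nil => simp
  | cons a w ih =>
    simp only [inputSize, List.map_cons, List.sum_cons] at *
    cases i with
    | zero => simp only [List.getD_cons_zero]; omega
    | succ i => rw [List.getD_cons_succ]; have := ih i; omega

/-- With at least one course, each table has `I.n * I.m ≥ I.m` entries, and every entry costs at
least one unit of input size. So the number of TAs, and with it each loop bound, is linear in the
input size, with a factor depending on `C` and `R`. -/
theorem bounds_of_n_ne_zero {I : Instance} (hn : I.n ≠ 0) (C R : ℕ) :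
    Bounds I C R ((C + 1) * (R + 1) * inputSize I.encode) := by
  have hlen := length_le_inputSize I.encode
  have hl : I.encode.length = 4 + I.n + 4 * (I.n * I.m) := by simp [encode]; ring
  have hsz := size_getD_le_inputSize I.encode
  generalize inputSize I.encode = S at *
  have hm : I.m ≤ I.n * I.m := Nat.le_mul_of_pos_left _ (Nat.pos_of_ne_zero hn)
  have hS : S ≤ (C + 1) * (R + 1) * S := Nat.le_mul_of_pos_left _ (by positivity)
  have hnS : I.n ≤ S := by omega
  have hnm : I.n * I.m + 1 ≤ S := by omega
  have h1 : 1 ≤ S := by omega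
  refine ⟨fun i => (hsz i).trans hS, by omega, by omega, by omega, ?_, ?_, ?_, ?_, ?_⟩
  · nlinarith [Nat.zero_le (C * R * S), Nat.zero_le (R * S), Nat.mul_le_mul_left C h1]
  · nlinarith [Nat.zero_le (C * R * S), Nat.zero_le (C * S), Nat.mul_le_mul_left R h1]
  · nlinarith [Nat.zero_le (C * R * S), Nat.zero_le (R * S), Nat.mul_le_mul_left C hnS]
  · nlinarith [Nat.zero_le (C * S), Nat.zero_le (R * S), Nat.mul_le_mul_left (R * C) hnS]
  · nlinarith [Nat.zero_le (C * R * S), Nat.zero_le (R * S), Nat.mul_le_mul_left C hnm]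

end MEFE.Code

theorem theorem10 (C R : ℕ) :
    RAM.SolvableInFPT (MEFE.Restricted C R) MEFE.Instance.encode (fun I => I.n)
      MEFE.Instance.CorrectAnswer := by
  obtain ⟨F, hF⟩ := MEFE.Code.exists_searchC_cost_le C R
  -- The summand `7` covers the test for `n = 0` and the short branch behind it.
  obtain ⟨K, d, hK⟩ := RAM.exists_eval_le_mul_pow (F + 7)
  refine ⟨(MEFE.Code.mainC C R).compile 0,
    fun n => 2 ^ (R * (C * n)) * (K * ((C + 1) * (R + 1) + 1) ^ d), d, ?_, fun I hI => ?_⟩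
  · have hpow : Primrec₂ ((· ^ ·) : ℕ → ℕ → ℕ) := Primrec₂.unpaired'.1 Nat.Primrec.pow
    exact (Primrec.nat_mul.comp (hpow.comp (Primrec.const 2) (Primrec.nat_mul.comp
      (Primrec.const R) (Primrec.nat_mul.comp (Primrec.const C) Primrec.id)))
      (Primrec.const _)).to_comp
  · have hs : (RAM.init I.encode).mem 0 = I.input := rfl
    obtain ⟨s, t, he, ht, hsim, -⟩ := (MEFE.Code.mainC C R).runs_compile 0 (RAM.init I.encode)
      (RAM.init I.encode) ⟨fun _ => rfl, rfl⟩
    refine ⟨s, t, he, ht.trans ?_, ?_⟩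
    · have hS := MEFE.Code.length_le_inputSize I.encode
      have hl : 1 ≤ I.encode.length := by simp [MEFE.Instance.encode]
      obtain ⟨B, hB⟩ : ∃ B, B = (C + 1) * (R + 1) * RAM.inputSize I.encode := ⟨_, rfl⟩
      have hbound : (MEFE.Code.mainC C R).cost (RAM.init I.encode) ≤
          2 ^ (R * (C * I.n)) * (F + 7).eval B := by
        have hp : 1 ≤ 2 ^ (R * (C * I.n)) := Nat.one_le_two_pow
        have hc : MEFE.Code.nE.cost (RAM.init I.encode) = 2 := rfl
        simp only [MEFE.Code.mainC, RAM.Cmd.cost, MEFE.Code.eval_nE hs, hc, RAM.Expr.cost,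
          Polynomial.eval_add, Polynomial.eval_ofNat, mul_add]
        split_ifs with hn
        · omega
        · have := hF I B (hB ▸ MEFE.Code.bounds_of_n_ne_zero hn C R) _ hs
          omega
      refine hbound.trans ?_
      rw [mul_assoc (2 ^ _), mul_assoc K, ← mul_pow]
      refine Nat.mul_le_mul_left _ ((hK _).trans (Nat.mul_le_mul_left _ ?_))
      refine Nat.pow_le_pow_left ?_ d
      -- As the input size is at least `1`, `B + 1` is at most `(C + 1) * (R + 1) + 1` times the
      -- input size; this constant moves into `f`.
      rw [add_mul, ← hB]
      omega
    · have := MEFE.Code.sem_mainC hI hs fun _ => rfl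
      rwa [← hsim.mem] at this
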